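/- For every $n\ge 1$ consider $n$ unit-size contents $i=1,\dots,n$ whose requests form independent, stationary and ergodic simple point processes $N_{n,1},\dots,N_{n,n}$ on $\mathbb R$, defined on a probability space $(\Omega,\mathbb P)$, with intensities $\lambda_{n,i}\in(0,\infty)$. Let $\mathbb P^0_{n,i}$ be the Palm probability of $N_{n,i}$ and $\mathbb P^0_n$ that of the superposition of $N_{n,1},\dots,N_{n,n}$. Let $G_{n,i}(t)$ be the $\mathbb P^0_{n,i}$-probability that the first request for content $i$ in $(0,\infty)$ occurs no later than $t$, and put $G^*_{n,i}(t)=G_{n,i}(t/\lambda_{n,i})$. Assume that all $G_{n,i}$ are continuous and that there is a continuous cdf $\Psi$ with support in $[0,\infty)$ and mean $m_\Psi>0$ such that $1-G^*_{n,i}(t)\ge 1-\Psi(t)$ for all $t,n,i$. Let $p_{n,i}=\lambda_{n,i}/\sum_{j=1}^n\lambda_{n,j}$, and let $\bar P_n(k)$ be the sum of the $n-k$ smallest of the numbers $p_{n,1},\dots,p_{n,n}$ (and $0$ if $k\ge n$). Let $Y_{n,i}(t)=1$ if content $i$ is requested during $[-t,0)$ and $Y_{n,i}(t)=0$ otherwise,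 and let $Y_n(t)=\sum_{i=1}^nY_{n,i}(t)$. Let the cache sizes satisfy $C_n\in(0,n)$ for all large $n$ and $C_n\to\infty$. Put $\tau_n=\inf\{t:Y_n(t)\ge C_n\}$, and let $T_n\ge 0$ be the characteristic time, i.e. $\mathbb E[Y_n(T_n)]=C_n$ (for all large $n$). With $X^0_n$ the content requested at time $0$ under $\mathbb P^0_n$, define the aggregate hit probabilities $$H_n^{\mathrm{LRU}}=\mathbb P^0_n[Y_{n,X^0_n}(\tau_n)=1],\qquad H_n^{\mathrm{TTL}}(T)=\mathbb P^0_n[Y_{n,X^0_n}(T)=1].$$ Assume: (C1) there is $\beta_1\in(0,m_\Psi)$ with $C_n\le\beta_1 n$ for all large $n$; (P1) there are $\kappa_1\in(1/m_\Psi,1/\beta_1)$, $\kappa_2\in[0,1]$ and $\gamma\in(0,1)$ such that $\bar P_n(\lceil\kappa_1C_n\rceil)>\gamma\,\bar P_n(\lfloor\kappa_2C_n\rfloor)$ for all large $n$. Call a family $\mathscr F$ of functions on $\mathbb R$ equicontinuous if for every $\epsilon>0$ there is $\delta>0$ such that $|x_1-x_2|<\delta$ implies $|f(x_1)-f(x_2)|<\epsilon$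 for every $f\in\mathscr F$. Suppose that either (R2) the family $\{G^*_{n,i}:n\ge i\ge1\}$ is equicontinuous, or (R1) for each $i\ge1$ the family $\{G^*_{n,i}:n\ge i\}$ is equicontinuous, and moreover $\lim_{m\to\infty}\limsup_{n\to\infty}\bar P_n(m)=0$. Then $$\bigl|H_n^{\mathrm{LRU}}-H_n^{\mathrm{TTL}}(T_n)\bigr|\to0\qquad\text{as }n\to\infty .$$ -/

import Mathlib

open MeasureTheory ProbabilityTheory Filter Topology Set
open scoped ENNReal

noncomputable section

/-- A realization of a simple point process on the line: a locally finite set of points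
(possibly finite or empty to the left or to the right). -/
@[ext]
structure PointConfig where
  points : Set ℝ
  locallyFinite : ∀ a b : ℝ, (points ∩ Icc a b).Finite

namespace PointConfig

/-- The number of points in `B`. -/
def count (c : PointConfig) (B : Set ℝ) : ℕ∞ := (c.points ∩ B).encard

/-- The usual sigma-algebra: the smallest one for which all counts `c ↦ c.count B`,
`B` a Borel set, are measurable. -/
instance : MeasurableSpace PointConfig :=
  ⨆ B : {B : Set ℝ // MeasurableSet B},
    MeasurableSpace.comap (fun c : PointConfig => c.count B.1) inferInstance

/-- The shift that moves the time origin to `t`. -/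
def shift (t : ℝ) (c : PointConfig) : PointConfig where
  points := {x | x + t ∈ c.points}
  locallyFinite a b := by
    refine ((c.locallyFinite (a + t) (b + t)).preimage
      (add_left_injective t).injOn).subset ?_
    rintro x ⟨hx, hxa, hxb⟩
    exact ⟨hx, by constructor <;> simpa using by assumption⟩

/-- The superposition of finitely many point configurations. -/
def superposition {n : ℕ} (ω : Fin n → PointConfig) : PointConfig where
  points := ⋃ i, (ω i).points
  locallyFinite a b := by
    rw [iUnion_inter]
    exact finite_iUnion fun i => (ω i).locallyFinite a b

/-- The first point `t(1)` in `(0, ∞)`, equal to `∞` if there is none. -/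
def nextPoint (c : PointConfig) : EReal :=
  sInf ((fun x : ℝ => (x : EReal)) '' (c.points ∩ Ioi 0))

/-- The law `ν` of a point process is stationary. -/
def IsStationary (ν : Measure PointConfig) : Prop :=
  ∀ t : ℝ, MeasurePreserving (shift t) ν ν

/-- The law `ν` of a (stationary) point process is ergodic: every shift-invariant event is trivial. -/
def IsErgodic (ν : Measure PointConfig) : Prop :=
  ∀ A : Set PointConfig, MeasurableSet A → (∀ t : ℝ, shift t ⁻¹' A = A) → ν A = 0 ∨ ν A = 1

end PointConfig

namespace Cache

/-- The joint law of the `n` request processes. -/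
def jointLaw {Ω : Type*} [MeasurableSpace Ω] (P : Measure Ω) {n : ℕ}
    (N : Fin n → Ω → PointConfig) : Measure (Fin n → PointConfig) :=
  P.map fun ω i => N i ω

/-- The simultaneous shift of all `n` configurations. -/
def shift {n : ℕ} (t : ℝ) (ω : Fin n → PointConfig) : Fin n → PointConfig :=
  fun i => (ω i).shift t

/-- The intensity (expected number of points in `(0, 1]`) of a point process `X` that is a
function of the `n` request processes. -/
def intensity {n : ℕ} (μ : Measure (Fin n → PointConfig))
    (X : (Fin n → PointConfig) → PointConfig) : ℝ≥0∞ :=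
  ∫⁻ ω, (((X ω).count (Ioc 0 1) : ℕ∞) : ℝ≥0∞) ∂μ

/-- The Palm probability of the event `A` associated with the point process `X` (in the
applications: one of the request processes, or their superposition), given by
`(1 / intensity) * E [∑_{t ∈ X ∩ (0, 1]} 1_A (θ_t ω)]`. -/
def palmProb {n : ℕ} (μ : Measure (Fin n → PointConfig))
    (X : (Fin n → PointConfig) → PointConfig) (A : Set (Fin n → PointConfig)) : ℝ≥0∞ :=
  (∫⁻ ω, ∑' t : ↥((X ω).points ∩ Ioc 0 1), A.indicator (fun _ => (1 : ℝ≥0∞)) (shift t.1 ω) ∂μ)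
    / intensity μ X

/-- The request rate `λ_i` of content `i`. -/
def rate {n : ℕ} (μ : Measure (Fin n → PointConfig)) (i : Fin n) : ℝ :=
  (intensity μ fun ω => ω i).toReal

/-- The popularity `p_i = λ_i / Λ` of content `i`. -/
def popularity {n : ℕ} (μ : Measure (Fin n → PointConfig)) (i : Fin n) : ℝ :=
  rate μ i / ∑ j, rate μ j

/-- The tail popularity: the total popularity of the `n - k` least popular contents.
`Tuple.sort` of the negated popularities arranges the contents in decreasing order of popularity;
the content of rank `j + 1` is the one in position `j`. -/
def tailPopularity {n : ℕ} (μ : Measure (Fin n → PointConfig)) (k : ℕ) : ℝ :=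
  ∑ j ∈ Finset.univ.filter (fun j : Fin n => k ≤ j.val),
    popularity μ (Tuple.sort (fun i => -popularity μ i) j)

/-- The cdf `G_i` of the inter-request time of content `i` under its Palm probability. -/
def interCdf {n : ℕ} (μ : Measure (Fin n → PointConfig)) (i : Fin n) (t : ℝ) : ℝ :=
  (palmProb μ (fun ω => ω i) {ω | (ω i).nextPoint ≤ (t : EReal)}).toReal

/-- The standardized inter-request cdf `G_i^*(t) = G_i(t / λ_i)`. -/
def scaledCdf {n : ℕ} (μ : Measure (Fin n → PointConfig)) (i : Fin n) (t : ℝ) : ℝ :=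
  interCdf μ i (t / rate μ i)

open Classical in
/-- `Y_i(t) = 1` if content `i` is requested during `[-t, 0)`, and `Y_i(t) = 0` otherwise. -/
def requested {n : ℕ} (i : Fin n) (t : EReal) (ω : Fin n → PointConfig) : ℝ :=
  if ∃ x ∈ (ω i).points, x < 0 ∧ ((-x : ℝ) : EReal) ≤ t then 1 else 0

/-- `Y(t)`, the number of distinct contents requested during `[-t, 0)`. -/
def numRequested {n : ℕ} (t : EReal) (ω : Fin n → PointConfig) : ℝ :=
  ∑ i, requested i t ω

/-- `τ = inf {t : Y(t) ≥ C}`, equal to `∞` if there is no such `t`. -/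
def fillTime {n : ℕ} (C : ℝ) (ω : Fin n → PointConfig) : EReal :=
  sInf {t : EReal | C ≤ numRequested t ω}

/-- `K(T) = E[Y(T)]`, the expected number of contents in a TTL cache with timer `T`. -/
def expectedSize {n : ℕ} (μ : Measure (Fin n → PointConfig)) (T : ℝ) : ℝ :=
  ∫ ω, numRequested (T : EReal) ω ∂μ

/-- The aggregate hit probability of an LRU cache of size `C`: under the Palm probability of the
superposed request process, the content `i` requested at time `0` satisfies `Y_i(τ) = 1`. -/
def hitLRU {n : ℕ} (μ : Measure (Fin n → PointConfig)) (C : ℝ) : ℝ :=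
  (palmProb μ PointConfig.superposition
    {ω | ∃ i, 0 ∈ (ω i).points ∧ requested i (fillTime C ω) ω = 1}).toReal

/-- The aggregate hit probability of a TTL cache with timer `T`: under the Palm probability of the
superposed request process, the content `i` requested at time `0` satisfies `Y_i(T) = 1`. -/
def hitTTL {n : ℕ} (μ : Measure (Fin n → PointConfig)) (T : ℝ) : ℝ :=
  (palmProb μ PointConfig.superposition
    {ω | ∃ i, 0 ∈ (ω i).points ∧ requested i (T : EReal) ω = 1}).toReal

/-- The family of the standardized inter-request cdfs of content `i` (contents are numbered from
`0`), over all system sizes `n` in which this content occurs. -/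
def contentFamily {Ω : Type*} [MeasurableSpace Ω] (P : Measure Ω)
    (N : (n : ℕ) → Fin n → Ω → PointConfig) (i : ℕ) : Set (ℝ → ℝ) :=
  {g | ∃ (n : ℕ) (h : i < n), g = scaledCdf (jointLaw P (N n)) ⟨i, h⟩}

end Cache

end

/-! ### Point configurations as counting measures; measurability. -/

namespace PointConfig

/-! Seen from a typical request, the age of the content requested at time 0 has the law of its
inter-request time, so a TTL cache with timer `t` has hit probability `H(t) = ∑ p_i G_i(t)`
(`palmMeasure_requestedSet`, `hitTTL_eq_meanCdf`). An LRU cache behaves like a TTL cache with random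
timer `τ`. Conditioning on a request for `i` leaves the law of the other processes unchanged
(`palmMeasure_of_update`), and the number of other contents requested in `[-t, 0)` is a sum of
independent indicators, whose variance is at most its mean. Choose `t₁ ≤ T ≤ t₂` where the expected
size `K` equals `(1 - δ) C` and `(1 + δ) C`. By Chebyshev the cache fills between `t₁` and `t₂` up
to an error of order `1 / (δ² C)`, whence `|H_LRU - H_TTL| ≤ H(t₂) - H(t₁) + 8 / (δ² C)`
(`abs_hitLRU_sub_hitTTL_le`).

It remains to make `H(t₂) - H(t₁)` small for small `δ`, uniformly in large `n`. By the inversion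
formula `K(t) = ∑ S_i(λ_i t)`, where `S_i(z) = ∫_0^z (1 - G*_i)` is a probability, hence at most 1.

Under (R2) and (P1) there is a dichotomy (`IsRegular.meanCdf_sub_le`). Contents ranked beyond `κ₁ C`
have `λ_i T ≤ v`, where `v` depends only on `Ψ` and `κ₁` and `Ψ(v) < 1`. If these contents receive
at least a fixed multiple of `C` requests on average during a window of length `T`, then `K` grows
at a definite rate near `T`. Hence `t₁` and `t₂` lie in `[(1 - e) T, (1 + e) T]` (`times_close`),
and equicontinuity bounds the increment of `H`, large arguments being handled by `1 - G*(z) ≤ 1 /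
z`. Otherwise (P1) says that the contents ranked beyond `C` are hardly requested either. The top `C`
contents then account for almost all of the expected size, so almost all of them are present with
probability near 1, and `H(t₁)` is near 1.

When the popularity tail is uniformly light, boundedly many contents carry almost all requests while
`C → ∞`, so `H(t₁)` is again near 1 (`IsRegular.one_sub_meanCdf_le_of_tail`). -/

theorem countable_points (c : PointConfig) : c.points.Countable := by
  have h : c.points = ⋃ n : ℕ, c.points ∩ Icc (-(n : ℝ)) n := by
    rw [← inter_iUnion, eq_comm, inter_eq_left]
    intro x _
    obtain ⟨n, hn⟩ := exists_nat_ge |x|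
    exact mem_iUnion.2 ⟨n, abs_le.1 hn⟩
  rw [h]
  exact countable_iUnion fun n => (c.locallyFinite _ _).countable

theorem measurableSet_points (c : PointConfig) : MeasurableSet c.points :=
  c.countable_points.measurableSet

theorem measurable_count {B : Set ℝ} (hB : MeasurableSet B) :
    Measurable fun c : PointConfig => c.count B := by
  rw [measurable_iff_comap_le]
  exact le_iSup (fun B : {B : Set ℝ // MeasurableSet B} =>
    MeasurableSpace.comap (fun c : PointConfig => c.count B.1) inferInstance) ⟨B, hB⟩

theorem measurable_of_count {α : Type*} [MeasurableSpace α] {f : α → PointConfig}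
    (h : ∀ B, MeasurableSet B → Measurable fun a => (f a).count B) : Measurable f := by
  rw [measurable_iff_comap_le]
  unfold instMeasurableSpace
  rw [MeasurableSpace.comap_iSup]
  refine iSup_le fun B => ?_
  rw [MeasurableSpace.comap_comp, ← measurable_iff_comap_le]
  exact h B.1 B.2

/-- The counting measure of a point configuration. -/
noncomputable def pointMeasure (c : PointConfig) : Measure ℝ := Measure.count.restrict c.points

theorem pointMeasure_apply (c : PointConfig) {B : Set ℝ} (hB : MeasurableSet B) :
    c.pointMeasure B = (c.count B : ℝ≥0∞) := by
  rw [pointMeasure, Measure.restrict_apply hB, Measure.count_apply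
    (hB.inter c.measurableSet_points), count, inter_comm]

theorem lintegral_pointMeasure (c : PointConfig) (f : ℝ → ℝ≥0∞) :
    ∫⁻ x, f x ∂c.pointMeasure = ∑' x, c.points.indicator f x := by
  rw [pointMeasure, ← lintegral_indicator c.measurableSet_points, lintegral_count]

theorem tsum_points_inter (c : PointConfig) {I : Set ℝ} (f : ℝ → ℝ≥0∞) :
    ∑' t : ↥(c.points ∩ I), f t.1 = ∫⁻ x, I.indicator f x ∂c.pointMeasure := by
  rw [lintegral_pointMeasure, indicator_indicator, tsum_subtype (c.points ∩ I) f]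

theorem measurable_toENNReal_count {B : Set ℝ} (hB : MeasurableSet B) :
    Measurable fun c : PointConfig => (c.count B : ℝ≥0∞) :=
  (Measurable.of_discrete (f := fun n : ℕ∞ => (n : ℝ≥0∞))).comp (measurable_count hB)

/-- The kernel sending a point configuration to its counting measure. -/
noncomputable def pointKernel : Kernel PointConfig ℝ where
  toFun := pointMeasure
  measurable' := by
    refine Measure.measurable_of_measurable_coe _ fun B hB => ?_
    simp_rw [pointMeasure_apply _ hB]
    exact measurable_toENNReal_count hB

@[simp] theorem pointKernel_apply (c : PointConfig) : pointKernel c = c.pointMeasure := rfl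

theorem count_ne_top (c : PointConfig) {B : Set ℝ} {a b : ℝ} (h : B ⊆ Icc a b) :
    c.count B ≠ ⊤ :=
  Set.encard_ne_top_iff.2 ((c.locallyFinite a b).subset (inter_subset_inter_right _ h))

theorem measurableSet_count_eq {B : Set ℝ} (hB : MeasurableSet B) (m : ℕ∞) :
    MeasurableSet {c : PointConfig | c.count B = m} :=
  measurable_count hB (measurableSet_singleton m)

open Classical in
-- The counts are finite but unbounded over configurations. Splitting by unit interval and by the
-- value `m` of the count there gives countably many kernels, each of total mass at most `m`.
instance : IsSFiniteKernel pointKernel := by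
  let η : ℤ × ℕ → Kernel PointConfig ℝ := fun p =>
    Kernel.piecewise (measurableSet_count_eq (measurableSet_Ioc (a := (p.1 : ℝ)) (b := p.1 + 1))
      (p.2 : ℕ∞)) (pointKernel.restrict (measurableSet_Ioc (a := (p.1 : ℝ)) (b := p.1 + 1))) 0
  have hη : ∀ p, IsFiniteKernel (η p) := by
    intro p
    refine ⟨p.2, by simp, fun c => ?_⟩
    simp only [η, Kernel.piecewise_apply]
    split_ifs with h
    · rw [Kernel.restrict_apply, Measure.restrict_apply_univ, pointKernel_apply,
        pointMeasure_apply _ measurableSet_Ioc, show c.count _ = _ from h]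
      simp
    · simp
  have h : pointKernel = Kernel.sum η := by
    ext c B hB
    rw [Kernel.sum_apply' _ _ hB, ENNReal.tsum_prod (f := fun j m => η (j, m) c B)]
    have h1 : ∀ j : ℤ, ∑' m : ℕ, η (j, m) c B = c.pointMeasure (B ∩ Ioc (j : ℝ) (j + 1)) := by
      intro j
      obtain ⟨m, hm⟩ := ENat.ne_top_iff_exists.1
        (c.count_ne_top (B := Ioc (j : ℝ) (j + 1)) Ioc_subset_Icc_self)
      rw [tsum_eq_single m]
      · simp only [η, Kernel.piecewise_apply]
        rw [if_pos (by exact hm.symm), Kernel.restrict_apply, Measure.restrict_apply hB,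
          pointKernel_apply]
      · intro m' hm'
        simp only [η, Kernel.piecewise_apply]
        rw [if_neg]
        · simp
        · intro h'
          exact hm' (by exact_mod_cast (show c.count _ = _ from h').symm.trans hm.symm)
    simp_rw [h1, pointKernel_apply]
    rw [← measure_iUnion]
    · rw [← inter_iUnion, iUnion_Ioc_intCast, inter_univ]
    · intro i j hij
      exact (pairwise_disjoint_Ioc_intCast ℝ hij).mono inter_subset_right inter_subset_right
    · exact fun j => hB.inter measurableSet_Ioc
  rw [h]
  exact Kernel.isSFiniteKernel_sum (hκs := fun p => inferInstance)

theorem pointMeasure_shift (t : ℝ) (c : PointConfig) :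
    (c.shift t).pointMeasure = c.pointMeasure.map (fun x => x - t) := by
  ext B hB
  have hm : Measurable fun x : ℝ => x - t := measurable_id.sub_const t
  rw [Measure.map_apply hm hB, pointMeasure_apply _ hB, pointMeasure_apply _ (hm hB)]
  congr 1
  rw [count, count]
  have : c.points ∩ (fun x => x - t) ⁻¹' B = (fun x => x + t) '' ((c.shift t).points ∩ B) := by
    ext x
    simp only [mem_inter_iff, mem_preimage, mem_image, shift, mem_ofPred_eq]
    constructor
    · rintro ⟨h1, h2⟩
      exact ⟨x - t, ⟨by simpa using h1, h2⟩, by simp⟩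
    · rintro ⟨y, ⟨h1, h2⟩, rfl⟩
      exact ⟨h1, by simpa using h2⟩
  rw [this, (add_left_injective t).encard_image]

theorem shift_shift (s t : ℝ) (c : PointConfig) : (c.shift t).shift s = c.shift (s + t) := by
  ext x
  simp [shift, add_assoc]

/-- A count after shifting is the integral of a translated indicator against `pointKernel`, so joint
measurability in time and configuration follows from that of kernel integrals. -/
theorem measurable_shift : Measurable fun p : ℝ × PointConfig => p.2.shift p.1 := by
  refine measurable_of_count fun B hB => ?_
  have h : Measurable fun p : ℝ × PointConfig => ((p.2.shift p.1).count B : ℝ≥0∞) := by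
    simp_rw [← pointMeasure_apply _ hB, pointMeasure_shift]
    have h2 : ∀ p : ℝ × PointConfig, p.2.pointMeasure.map (fun x => x - p.1) B
        = ∫⁻ x, B.indicator 1 (x - p.1) ∂(Kernel.prodMkLeft ℝ pointKernel p) := by
      intro p
      rw [Kernel.prodMkLeft_apply, pointKernel_apply, ← lintegral_indicator_one hB,
        lintegral_map (measurable_one.indicator hB) (measurable_sub_const p.1)]
    simp_rw [h2]
    refine Measurable.lintegral_kernel_prod_right' (f := fun q : (ℝ × PointConfig) × ℝ =>
      B.indicator 1 (q.2 - q.1.1)) ?_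
    exact (measurable_one.indicator hB).comp (measurable_snd.sub measurable_fst.fst)
  rw [ENat.measurable_iff]
  intro n
  have : (fun a : ℝ × PointConfig => (a.2.shift a.1).count B) ⁻¹' {(n : ℕ∞)}
      = (fun p : ℝ × PointConfig => ((p.2.shift p.1).count B : ℝ≥0∞)) ⁻¹' {(n : ℝ≥0∞)} := by
    ext p
    simp only [mem_preimage, mem_singleton_iff]
    rw [← ENat.toENNReal_coe, ENat.toENNReal_inj]
  rw [this]
  exact h (measurableSet_singleton _)

end PointConfig

/-! ### The Palm measure and Campbell's formula. -/

namespace PointConfig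

/-- The Palm measure (not normalized) of a point process with law `ν`. -/
noncomputable def palmMeasure (ν : Measure PointConfig) : Measure PointConfig :=
  (ν ⊗ₘ (pointKernel.restrict (measurableSet_Ioc (a := (0 : ℝ)) (b := 1)))).map
    fun p => p.1.shift p.2

theorem measurable_shift_swap : Measurable fun p : PointConfig × ℝ => p.1.shift p.2 :=
  measurable_shift.comp measurable_swap

theorem lintegral_palmMeasure (ν : Measure PointConfig) [SFinite ν] {f : PointConfig → ℝ≥0∞}
    (hf : Measurable f) : ∫⁻ c, f c ∂palmMeasure ν
      = ∫⁻ c, ∫⁻ x in Ioc 0 1, f (c.shift x) ∂c.pointMeasure ∂ν := by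
  rw [palmMeasure, lintegral_map hf measurable_shift_swap,
    Measure.lintegral_compProd (f := fun p : PointConfig × ℝ => f (p.1.shift p.2))
      (hf.comp measurable_shift_swap)]
  simp [Kernel.restrict_apply]

theorem palmMeasure_apply (ν : Measure PointConfig) [SFinite ν] {A : Set PointConfig}
    (hA : MeasurableSet A) : palmMeasure ν A
      = ∫⁻ c, ∫⁻ x in Ioc 0 1, A.indicator 1 (c.shift x) ∂c.pointMeasure ∂ν := by
  rw [← lintegral_indicator_one hA, lintegral_palmMeasure ν (measurable_one.indicator hA)]

theorem palmMeasure_univ (ν : Measure PointConfig) [SFinite ν] :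
    palmMeasure ν univ = ∫⁻ c, (c.count (Ioc 0 1) : ℝ≥0∞) ∂ν := by
  rw [palmMeasure_apply ν MeasurableSet.univ]
  simp [pointMeasure_apply _ measurableSet_Ioc]

/-- The points of the process, together with the process seen from them. -/
noncomputable def campbellMeasure (ν : Measure PointConfig) : Measure (ℝ × PointConfig) :=
  (ν ⊗ₘ pointKernel).map fun p => (p.2, p.1.shift p.2)

theorem lintegral_campbellMeasure (ν : Measure PointConfig) [SFinite ν]
    {f : ℝ × PointConfig → ℝ≥0∞} (hf : Measurable f) : ∫⁻ p, f p ∂campbellMeasure ν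
      = ∫⁻ c, ∫⁻ x, f (x, c.shift x) ∂c.pointMeasure ∂ν := by
  have hm : Measurable fun p : PointConfig × ℝ => (p.2, p.1.shift p.2) :=
    measurable_snd.prodMk measurable_shift_swap
  rw [campbellMeasure, lintegral_map hf hm, Measure.lintegral_compProd
    (f := fun p : PointConfig × ℝ => f (p.2, p.1.shift p.2)) (hf.comp hm)]
  simp

theorem measurable_lintegral_shift {f : ℝ × PointConfig → ℝ≥0∞} (hf : Measurable f) :
    Measurable fun c : PointConfig => ∫⁻ x, f (x, c.shift x) ∂c.pointMeasure :=
  Measurable.lintegral_kernel_prod_right' (κ := pointKernel)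
    (f := fun p : PointConfig × ℝ => f (p.2, p.1.shift p.2))
    (hf.comp (measurable_snd.prodMk measurable_shift_swap))

/-- Shifting the configuration moves each point but not what is seen from it; stationarity absorbs
the shift. -/
theorem lintegral_campbellMeasure_translate {ν : Measure PointConfig} [SFinite ν]
    (hν : IsStationary ν) {f : ℝ × PointConfig → ℝ≥0∞} (hf : Measurable f) (t : ℝ) :
    ∫⁻ p, f (p.1 + t, p.2) ∂campbellMeasure ν = ∫⁻ p, f p ∂campbellMeasure ν := by
  have hf' : Measurable fun p : ℝ × PointConfig => f (p.1 + t, p.2) :=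
    hf.comp ((measurable_fst.add_const t).prodMk measurable_snd)
  rw [lintegral_campbellMeasure ν hf, lintegral_campbellMeasure ν hf',
    ← (hν t).lintegral_comp (measurable_lintegral_shift hf')]
  refine lintegral_congr fun c => ?_
  rw [pointMeasure_shift, lintegral_map]
  · simp [shift_shift]
  · exact hf'.comp (measurable_id.prodMk (measurable_shift.comp
      (measurable_id.prodMk measurable_const)))
  · exact measurable_sub_const t

/-- For fixed `A`, the mass as a function of `B` is a translation-invariant measure on the line that
is finite on compacts. By uniqueness of Haar measure it is a multiple of Lebesgue measure, and `B =
(0, 1]` identifies the constant. -/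
theorem campbellMeasure_prod {ν : Measure PointConfig} [SFinite ν]
    (hν : IsStationary ν) (hfin : palmMeasure ν univ ≠ ∞) {A : Set PointConfig}
    (hA : MeasurableSet A) {B : Set ℝ} (hB : MeasurableSet B) :
    campbellMeasure ν (B ×ˢ A) = volume B * palmMeasure ν A := by
  let M : Measure ℝ := ((campbellMeasure ν).restrict (univ ×ˢ A)).map Prod.fst
  have hM : ∀ B : Set ℝ, MeasurableSet B → M B = campbellMeasure ν (B ×ˢ A) := by
    intro B hB
    rw [Measure.map_apply measurable_fst hB, Measure.restrict_apply (measurable_fst hB)]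
    congr 1
    ext p
    simp
  have htrans : ∀ (t : ℝ) (B : Set ℝ), MeasurableSet B →
      M ((fun x => x + t) ⁻¹' B) = M B := by
    intro t B hB
    have hB' : MeasurableSet ((fun x => x + t) ⁻¹' B) := (measurable_add_const t) hB
    rw [hM _ hB, hM _ hB', ← lintegral_indicator_one (hB.prod hA),
      ← lintegral_indicator_one (hB'.prod hA),
      ← lintegral_campbellMeasure_translate hν (measurable_one.indicator (hB.prod hA)) t]
    rfl
  have h01 : M (Ioc 0 1) = palmMeasure ν A := by
    rw [hM _ measurableSet_Ioc, ← lintegral_indicator_one (measurableSet_Ioc.prod hA),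
      lintegral_campbellMeasure ν (measurable_one.indicator (measurableSet_Ioc.prod hA)),
      palmMeasure_apply ν hA]
    refine lintegral_congr fun c => ?_
    rw [← lintegral_indicator measurableSet_Ioc]
    refine lintegral_congr fun x => ?_
    by_cases h1 : x ∈ Ioc (0 : ℝ) 1 <;> by_cases h2 : c.shift x ∈ A <;> simp [h1, h2]
  have hIoc : ∀ j : ℤ, M (Ioc (j : ℝ) (j + 1)) = palmMeasure ν A := by
    intro j
    rw [← h01, ← htrans j _ measurableSet_Ioc]
    congr 1
    ext x
    simp
  have hfinA : palmMeasure ν A < ∞ := (measure_mono (subset_univ A)).trans_lt hfin.lt_top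
  have hcomp : IsFiniteMeasureOnCompacts M := by
    refine ⟨fun K hK => ?_⟩
    obtain ⟨r, hr⟩ := hK.isBounded.subset_closedBall 0
    obtain ⟨k, hk⟩ := exists_nat_gt r
    have hsub : K ⊆ ⋃ j ∈ Finset.Icc (-(k : ℤ) - 1) k, Ioc (j : ℝ) (j + 1) := by
      intro x hx
      have hx' := hr hx
      rw [Metric.mem_closedBall, dist_zero_right, Real.norm_eq_abs, abs_le] at hx'
      have hu : x ∈ ⋃ j : ℤ, Ioc (j : ℝ) (j + 1) := by rw [iUnion_Ioc_intCast]; trivial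
      obtain ⟨j, hj⟩ := mem_iUnion.1 hu
      refine mem_iUnion₂.2 ⟨j, Finset.mem_Icc.2 ⟨?_, ?_⟩, hj⟩
      · have : (-(k : ℝ)) - 1 < j := by linarith [hj.2, hx'.1]
        exact_mod_cast this.le
      · have : (j : ℝ) < k := by linarith [hj.1, hx'.2]
        exact_mod_cast this.le
    refine (measure_mono hsub).trans_lt ((measure_biUnion_finset_le _ _).trans_lt ?_)
    simp_rw [hIoc]
    exact ENNReal.sum_lt_top.2 fun _ _ => hfinA
  have hinv : M.IsAddLeftInvariant := by
    refine ⟨fun t => ?_⟩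
    ext B hB
    rw [Measure.map_apply (measurable_const_add t) hB]
    simp_rw [add_comm t]
    exact htrans t B hB
  have h := Measure.isAddLeftInvariant_eq_smul M volume
  rw [← hM B hB, ← h01, h]
  simp [mul_comm]

theorem campbellMeasure_eq {ν : Measure PointConfig} [SFinite ν]
    (hν : IsStationary ν) (hfin : palmMeasure ν univ ≠ ∞) :
    campbellMeasure ν = volume.prod (palmMeasure ν) := by
  have : IsFiniteMeasure (palmMeasure ν) := ⟨hfin.lt_top⟩
  exact (Measure.prod_eq fun B A hB hA => campbellMeasure_prod hν hfin hA hB).symm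

/-- Campbell's formula. -/
theorem lintegral_sum_points {ν : Measure PointConfig} [SFinite ν]
    (hν : IsStationary ν) (hfin : palmMeasure ν univ ≠ ∞)
    {f : ℝ × PointConfig → ℝ≥0∞} (hf : Measurable f) :
    ∫⁻ c, ∫⁻ x, f (x, c.shift x) ∂c.pointMeasure ∂ν
      = ∫⁻ x, ∫⁻ c, f (x, c) ∂palmMeasure ν := by
  have : IsFiniteMeasure (palmMeasure ν) := ⟨hfin.lt_top⟩
  rw [← lintegral_campbellMeasure ν hf, campbellMeasure_eq hν hfin, lintegral_prod _ hf.aemeasurable]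

end PointConfig

/-! ### Inversion formulas for the probability of a point in a window. -/

namespace PointConfig

theorem measurable_pointMeasure_section {α : Type*} [MeasurableSpace α] {f : α → PointConfig}
    (hf : Measurable f) {S : Set (α × ℝ)} (hS : MeasurableSet S) :
    Measurable fun a => (f a).pointMeasure (Prod.mk a ⁻¹' S) :=
  Kernel.measurable_kernel_prodMk_left (κ := pointKernel.comap f hf) hS

theorem pointMeasure_eq_zero_iff (c : PointConfig) {B : Set ℝ} (hB : MeasurableSet B) :
    c.pointMeasure B = 0 ↔ ¬ (c.points ∩ B).Nonempty := by
  rw [pointMeasure_apply _ hB, not_nonempty_iff_eq_empty, ENat.toENNReal_eq_zero, count,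
    encard_eq_zero]

theorem measurableSet_nonempty_section {α : Type*} [MeasurableSpace α] {f : α → PointConfig}
    (hf : Measurable f) {S : Set (α × ℝ)} (hS : MeasurableSet S) :
    MeasurableSet {a | ((f a).points ∩ Prod.mk a ⁻¹' S).Nonempty} := by
  have h : {a | ((f a).points ∩ Prod.mk a ⁻¹' S).Nonempty}
      = (fun a => (f a).pointMeasure (Prod.mk a ⁻¹' S)) ⁻¹' {0}ᶜ := by
    ext a
    simp only [mem_preimage, mem_compl_iff, mem_singleton_iff]
    rw [pointMeasure_eq_zero_iff _ (measurable_prodMk_left hS), not_not]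
    rfl
  rw [h]
  exact measurable_pointMeasure_section hf hS (measurableSet_singleton 0).compl

theorem measurableSet_nonempty {B : Set ℝ} (hB : MeasurableSet B) :
    MeasurableSet {c : PointConfig | (c.points ∩ B).Nonempty} := by
  have h := measurableSet_nonempty_section (f := fun c : PointConfig => c) measurable_id
    (measurable_snd hB)
  exact h

theorem mem_points_shift {c : PointConfig} {t x : ℝ} : x ∈ (c.shift t).points ↔ x + t ∈ c.points :=
  Iff.rfl

/-- Local finiteness makes the infimum attained: no points accumulate at `s` from the right. -/
theorem nextPoint_le_iff (c : PointConfig) (s : ℝ) :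
    c.nextPoint ≤ (s : EReal) ↔ (c.points ∩ Ioc 0 s).Nonempty := by
  constructor
  · intro h
    by_contra hne
    rw [not_nonempty_iff_eq_empty] at hne
    by_cases hs : s < 0
    · refine absurd h (not_le.2 (lt_of_lt_of_le (b := (0 : EReal)) (by exact_mod_cast hs) ?_))
      refine le_sInf ?_
      rintro _ ⟨x, hx, rfl⟩
      exact EReal.coe_le_coe_iff.2 (le_of_lt hx.2)
    push Not at hs
    have hfin := c.locallyFinite 0 (s + 1)
    have hfin' : (c.points ∩ Ioc s (s + 1)).Finite := hfin.subset
      (inter_subset_inter_right _ fun x hx => ⟨hs.trans hx.1.le, hx.2⟩)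
    obtain ⟨b, hb, hsb⟩ : ∃ b, s < b ∧ ∀ x ∈ c.points ∩ Ioc s (s + 1), b ≤ x := by
      rcases (c.points ∩ Ioc s (s + 1)).eq_empty_or_nonempty with h0 | h0
      · exact ⟨s + 1, by linarith, by simp [h0]⟩
      · obtain ⟨m, hm, hmin⟩ := hfin'.exists_minimal h0
        refine ⟨m, hm.2.1, fun x hx => ?_⟩
        rcases le_total m x with h1 | h1
        · exact h1
        · exact hmin hx h1
    have : ((min b (s + 1) : ℝ) : EReal) ≤ c.nextPoint := by
      refine le_sInf ?_
      rintro _ ⟨x, hx, rfl⟩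
      rw [EReal.coe_le_coe_iff]
      rcases le_or_gt x s with h1 | h1
      · exact absurd (show x ∈ c.points ∩ Ioc 0 s from ⟨hx.1, hx.2, h1⟩) (by simp [hne])
      · rcases le_or_gt x (s + 1) with h2 | h2
        · exact (min_le_left _ _).trans (hsb x ⟨hx.1, h1, h2⟩)
        · exact (min_le_right _ _).trans h2.le
    have h3 := EReal.coe_le_coe_iff.1 (this.trans h)
    have : s < min b (s + 1) := lt_min hb (by linarith)
    linarith
  · rintro ⟨x, hx, hx0, hxs⟩
    have h1 : c.nextPoint ≤ (x : EReal) := sInf_le ⟨x, ⟨hx, hx0⟩, rfl⟩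
    exact h1.trans (EReal.coe_le_coe_iff.2 hxs)

variable {ν : Measure PointConfig} [IsProbabilityMeasure ν]

theorem measure_zero_mem (hν : IsStationary ν) (hfin : palmMeasure ν univ ≠ ∞) :
    ν {c | (0 : ℝ) ∈ c.points} = 0 := by
  have h := lintegral_sum_points hν hfin (f := fun p => ({0} : Set ℝ).indicator 1 p.1)
    ((measurable_one.indicator (measurableSet_singleton 0)).comp measurable_fst)
  have h0 : ∫⁻ x, ∫⁻ _, ({0} : Set ℝ).indicator (1 : ℝ → ℝ≥0∞) x ∂palmMeasure ν = 0 := by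
    simp_rw [lintegral_const]
    rw [lintegral_mul_const _ (measurable_one.indicator (measurableSet_singleton 0)),
      lintegral_indicator_one (measurableSet_singleton 0)]
    simp
  rw [h0, lintegral_eq_zero_iff (by
    simp only [lintegral_indicator_one (measurableSet_singleton (0 : ℝ))]
    exact pointKernel.measurable_coe (measurableSet_singleton 0))] at h
  rw [← compl_mem_ae_iff]
  filter_upwards [h] with c hc h0
  simp only [lintegral_indicator_one (measurableSet_singleton (0 : ℝ)), Pi.zero_apply] at hc
  rw [pointMeasure_eq_zero_iff _ (measurableSet_singleton 0)] at hc
  exact hc ⟨0, h0, rfl⟩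

/-- Lets the event that some point exists be written as a sum over the points, once a rule selects
exactly one of them. -/
theorem lintegral_indicator_subsingleton (c : PointConfig) {L : Set ℝ}
    (hsub : (c.points ∩ L).Subsingleton) {p : Prop} (hL : (c.points ∩ L).Nonempty ↔ p) :
    ∫⁻ x, L.indicator 1 x ∂c.pointMeasure = {_c : PointConfig | p}.indicator 1 c := by
  classical
  have h1 : ∫⁻ x, L.indicator 1 x ∂c.pointMeasure = ((c.points ∩ L).encard : ℝ≥0∞) := by
    rw [lintegral_pointMeasure, indicator_indicator]
    rw [← tsum_subtype (c.points ∩ L) (1 : ℝ → ℝ≥0∞)]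
    simp
  rw [h1]
  by_cases h : (c.points ∩ L).Nonempty
  · obtain ⟨m, hm⟩ := h
    rw [hsub.eq_singleton_of_mem hm]
    simp [hL.1 ⟨m, hm⟩]
  · have hp : ¬ p := fun hp => h (hL.2 hp)
    rw [not_nonempty_iff_eq_empty.1 h]
    simp [hp]

/-- The inversion formula, decomposing with respect to the last point before the origin. -/
theorem measure_nonempty_eq_lintegral_next (hν : IsStationary ν) (hfin : palmMeasure ν univ ≠ ∞)
    (t : ℝ) : ν {c | (c.points ∩ Ico (-t) 0).Nonempty}
      = ∫⁻ u in Ioc 0 t, palmMeasure ν {c | (c.points ∩ Ioc 0 u).Nonempty}ᶜ := by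
  -- A point `x` of `[-t, 0)` is selected if, seen from it, `(0, -x]` is empty, that is, if no point
  -- follows it up to time 0.
  let S : Set (ℝ × PointConfig) :=
    {p | p.1 ∈ Ico (-t) 0} ∩ {p | (p.2.points ∩ Ioc 0 (-p.1)).Nonempty}ᶜ
  have hS : MeasurableSet S := by
    refine (measurable_fst measurableSet_Ico).inter (MeasurableSet.compl ?_)
    exact measurableSet_nonempty_section (f := Prod.snd) measurable_snd
      (S := {q : (ℝ × PointConfig) × ℝ | 0 < q.2 ∧ q.2 ≤ -q.1.1})
      ((measurableSet_lt measurable_const measurable_snd).inter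
        (measurableSet_le measurable_snd measurable_fst.fst.neg))
  have h := lintegral_sum_points hν hfin (f := S.indicator 1) (measurable_one.indicator hS)
  have hl : ν {c | (c.points ∩ Ico (-t) 0).Nonempty}
      = ∫⁻ c, ∫⁻ x, S.indicator 1 (x, c.shift x) ∂c.pointMeasure ∂ν := by
    rw [← lintegral_indicator_one (measurableSet_nonempty measurableSet_Ico)]
    refine lintegral_congr_ae ?_
    -- A point at the origin would disqualify every candidate, since `(0, -x]` seen from `x`
    -- contains it; this has probability zero.
    filter_upwards [compl_mem_ae_iff.2 (measure_zero_mem hν hfin)] with c hc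
    have h1 := c.lintegral_indicator_subsingleton (L := {x | (x, c.shift x) ∈ S})
      (p := (c.points ∩ Ico (-t) 0).Nonempty) ?_ ?_
    · exact h1.symm
    · rintro x ⟨hx, hx1, hx2⟩ y ⟨hy, hy1, hy2⟩
      by_contra hxy
      wlog hlt : x < y generalizing x y
      · exact this hy hy1 hy2 hx hx1 hx2 (Ne.symm hxy) (lt_of_le_of_ne (not_lt.1 hlt) (Ne.symm hxy))
      refine hx2 ⟨y - x, ?_, ?_, ?_⟩
      · simpa [mem_points_shift] using hy
      · simpa using hlt
      · have := hy1.2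
        simp only
        linarith
    · constructor
      · rintro ⟨x, hx, hx1, -⟩
        exact ⟨x, hx, hx1⟩
      · intro hne
        have hfin : (c.points ∩ Ico (-t) 0).Finite :=
          (c.locallyFinite (-t) 0).subset (inter_subset_inter_right _ Ico_subset_Icc_self)
        obtain ⟨m, hm, hmax⟩ := hfin.exists_maximal hne
        refine ⟨m, hm.1, hm.2, ?_⟩
        rintro ⟨y, hy, hy0, hy1⟩
        rw [mem_points_shift] at hy
        simp only at hy0 hy1
        have hy3 : y + m ≠ 0 := fun h0 => hc (by rw [h0] at hy; exact hy)
        have hy4 : y + m < 0 := lt_of_le_of_ne (by linarith) hy3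
        have := hmax (y := y + m) ⟨hy, by linarith [hm.2.1], hy4⟩ (by linarith)
        linarith
  rw [hl, h]
  have h2 : ∀ x, ∫⁻ c, S.indicator 1 (x, c) ∂palmMeasure ν = (Ioc 0 t).indicator
      (fun u => palmMeasure ν {c | (c.points ∩ Ioc 0 u).Nonempty}ᶜ) (-x) := by
    intro x
    by_cases hx : x ∈ Ico (-t) 0
    · have hx' : -x ∈ Ioc 0 t := ⟨by linarith [hx.2], by linarith [hx.1]⟩
      rw [indicator_of_mem hx', ← lintegral_indicator_one (measurableSet_nonempty
        measurableSet_Ioc).compl]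
      refine lintegral_congr fun c => ?_
      by_cases hc : (c.points ∩ Ioc 0 (-x)).Nonempty <;> simp [S, hx.1, hx.2, hc]
    · have hx' : -x ∉ Ioc 0 t := fun h => hx ⟨by linarith [h.2], by linarith [h.1]⟩
      rw [indicator_of_notMem hx']
      have : ∀ c, S.indicator (1 : ℝ × PointConfig → ℝ≥0∞) (x, c) = 0 := fun c =>
        indicator_of_notMem (fun h => hx h.1) _
      simp [this]
  simp_rw [h2]
  rw [lintegral_neg_eq_self (μ := volume) (Set.indicator (Ioc 0 t) _),
    lintegral_indicator measurableSet_Ioc]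

/-- The inversion formula, decomposing with respect to the first point after `-t`. -/
theorem measure_nonempty_eq_lintegral_prev (hν : IsStationary ν) (hfin : palmMeasure ν univ ≠ ∞)
    (t : ℝ) : ν {c | (c.points ∩ Ico (-t) 0).Nonempty}
      = ∫⁻ u in Ico 0 t, palmMeasure ν {c | (c.points ∩ Ico (-u) 0).Nonempty}ᶜ := by
  -- Here `x` is selected if there is no point in `[-t, x)`. The origin plays no role, so the
  -- identity below holds for every configuration.
  let S : Set (ℝ × PointConfig) :=
    {p | p.1 ∈ Ico (-t) 0} ∩ {p | (p.2.points ∩ Ico (-(p.1 + t)) 0).Nonempty}ᶜ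
  have hS : MeasurableSet S := by
    refine (measurable_fst measurableSet_Ico).inter (MeasurableSet.compl ?_)
    exact measurableSet_nonempty_section (f := Prod.snd) measurable_snd
      (S := {q : (ℝ × PointConfig) × ℝ | -(q.1.1 + t) ≤ q.2 ∧ q.2 < 0})
      ((measurableSet_le (measurable_fst.fst.add_const t).neg measurable_snd).inter
        (measurableSet_lt measurable_snd measurable_const))
  have h := lintegral_sum_points hν hfin (f := S.indicator 1) (measurable_one.indicator hS)
  have hl : ν {c | (c.points ∩ Ico (-t) 0).Nonempty}
      = ∫⁻ c, ∫⁻ x, S.indicator 1 (x, c.shift x) ∂c.pointMeasure ∂ν := by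
    rw [← lintegral_indicator_one (measurableSet_nonempty measurableSet_Ico)]
    refine lintegral_congr fun c => ?_
    have h1 := c.lintegral_indicator_subsingleton (L := {x | (x, c.shift x) ∈ S})
      (p := (c.points ∩ Ico (-t) 0).Nonempty) ?_ ?_
    · exact h1.symm
    · rintro x ⟨hx, hx1, hx2⟩ y ⟨hy, hy1, hy2⟩
      by_contra hxy
      wlog hlt : x < y generalizing x y
      · exact this hy hy1 hy2 hx hx1 hx2 (Ne.symm hxy) (lt_of_le_of_ne (not_lt.1 hlt) (Ne.symm hxy))
      refine hy2 ⟨x - y, ?_, ?_, ?_⟩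
      · simpa [mem_points_shift] using hx
      · have := hx1.1
        simp only at this ⊢
        linarith
      · linarith
    · constructor
      · rintro ⟨x, hx, hx1, -⟩
        exact ⟨x, hx, hx1⟩
      · intro hne
        have hfin : (c.points ∩ Ico (-t) 0).Finite :=
          (c.locallyFinite (-t) 0).subset (inter_subset_inter_right _ Ico_subset_Icc_self)
        obtain ⟨m, hm, hmin⟩ := hfin.exists_minimal hne
        refine ⟨m, hm.1, hm.2, ?_⟩
        rintro ⟨y, hy, hy0, hy1⟩
        rw [mem_points_shift] at hy
        simp only at hy0 hy1
        have := hmin (y := y + m) ⟨hy, by linarith, by linarith [hm.2.2]⟩ (by linarith)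
        linarith
  rw [hl, h]
  have h2 : ∀ x, ∫⁻ c, S.indicator 1 (x, c) ∂palmMeasure ν = (Ico 0 t).indicator
      (fun u => palmMeasure ν {c | (c.points ∩ Ico (-u) 0).Nonempty}ᶜ) (x + t) := by
    intro x
    by_cases hx : x ∈ Ico (-t) 0
    · have hx' : x + t ∈ Ico 0 t := ⟨by linarith [hx.1], by linarith [hx.2]⟩
      rw [indicator_of_mem hx', ← lintegral_indicator_one (measurableSet_nonempty
        measurableSet_Ico).compl]
      refine lintegral_congr fun c => ?_
      by_cases hc : c ∈ {c : PointConfig | (c.points ∩ Ico (-(x + t)) 0).Nonempty}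
      · rw [indicator_of_notMem (fun h : (x, c) ∈ S => h.2 hc),
          indicator_of_notMem (notMem_compl_iff.2 hc)]
      · rw [indicator_of_mem (show (x, c) ∈ S from ⟨hx, hc⟩), indicator_of_mem hc]
        rfl
    · have hx' : x + t ∉ Ico 0 t := fun h => hx ⟨by linarith [h.1], by linarith [h.2]⟩
      rw [indicator_of_notMem hx']
      have : ∀ c, S.indicator (1 : ℝ × PointConfig → ℝ≥0∞) (x, c) = 0 := fun c =>
        indicator_of_notMem (fun h => hx h.1) _
      simp [this]
  simp_rw [h2]
  rw [lintegral_add_right_eq_self (Set.indicator (Ico 0 t) _), lintegral_indicator measurableSet_Ico]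

end PointConfig

/-! ### Under the Palm measure, previous and next points are equally far in law. -/

namespace PointConfig

variable {ν : Measure PointConfig} [IsProbabilityMeasure ν]

/-- The two inversion formulas give the forward and backward survival functions the same integral
over the interval from `u` to `v`. Both are antitone, so the value of either at `v` is at most the
mean, which is at most the value of the other at `u`. -/
theorem palmMeasure_prev_next_le (hν : IsStationary ν) (hfin : palmMeasure ν univ ≠ ∞) {u v : ℝ}
    (hu : 0 ≤ u) (huv : u < v) :
    palmMeasure ν {c | (c.points ∩ Ico (-v) 0).Nonempty}ᶜ
        ≤ palmMeasure ν {c | (c.points ∩ Ioc 0 u).Nonempty}ᶜ ∧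
      palmMeasure ν {c | (c.points ∩ Ioc 0 v).Nonempty}ᶜ
        ≤ palmMeasure ν {c | (c.points ∩ Ico (-u) 0).Nonempty}ᶜ := by
  set a : ℝ → ℝ≥0∞ := fun u => palmMeasure ν {c | (c.points ∩ Ioc 0 u).Nonempty}ᶜ with ha
  set b : ℝ → ℝ≥0∞ := fun u => palmMeasure ν {c | (c.points ∩ Ico (-u) 0).Nonempty}ᶜ with hb
  have hanti : Antitone a := fun s t hst => measure_mono (compl_subset_compl.2 fun c hc =>
    hc.mono (inter_subset_inter_right _ (Ioc_subset_Ioc_right hst)))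
  have hbnti : Antitone b := fun s t hst => measure_mono (compl_subset_compl.2 fun c hc =>
    hc.mono (inter_subset_inter_right _ (Ico_subset_Ico_left (neg_le_neg hst))))
  have hab : ∀ t, ∫⁻ x in Ioc 0 t, a x = ∫⁻ x in Ico 0 t, b x := fun t => by
    rw [← measure_nonempty_eq_lintegral_next hν hfin t,
      ← measure_nonempty_eq_lintegral_prev hν hfin t]
  have hsplit : ∫⁻ x in Ioc u v, a x = ∫⁻ x in Ico u v, b x := by
    have h1 : ∫⁻ x in Ioc 0 v, a x = (∫⁻ x in Ioc 0 u, a x) + ∫⁻ x in Ioc u v, a x := by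
      rw [← Ioc_union_Ioc_eq_Ioc hu huv.le, lintegral_union measurableSet_Ioc
        (Ioc_disjoint_Ioc_of_le le_rfl)]
    have h2 : ∫⁻ x in Ico 0 v, b x = (∫⁻ x in Ico 0 u, b x) + ∫⁻ x in Ico u v, b x := by
      rw [← Ico_union_Ico_eq_Ico hu huv.le, lintegral_union measurableSet_Ico
        (Ico_disjoint_Ico_same)]
    rw [hab, h2, ← hab u] at h1
    have hne : ∫⁻ x in Ioc 0 u, a x ≠ ∞ := by
      rw [← measure_nonempty_eq_lintegral_next hν hfin u]
      exact measure_ne_top _ _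
    exact ((ENNReal.add_right_inj hne).1 h1).symm
  have hvol : (0 : ℝ≥0∞) < ENNReal.ofReal (v - u) := by simpa using huv
  have key : ∀ {p q : ℝ≥0∞}, p * ENNReal.ofReal (v - u) ≤ q * ENNReal.ofReal (v - u) → p ≤ q :=
    fun h => (ENNReal.mul_le_mul_iff_left hvol.ne' ENNReal.ofReal_ne_top).1 h
  have lower : ∀ {f : ℝ → ℝ≥0∞} {s : Set ℝ}, MeasurableSet s → Antitone f →
      s ⊆ Icc u v → volume s = ENNReal.ofReal (v - u) →
      f v * ENNReal.ofReal (v - u) ≤ ∫⁻ x in s, f x ∧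
      ∫⁻ x in s, f x ≤ f u * ENNReal.ofReal (v - u) := by
    intro f s hs hf hsub hv
    rw [← hv, ← setLIntegral_const, ← setLIntegral_const]
    exact ⟨setLIntegral_mono' hs fun x hx => hf (hsub hx).2,
      setLIntegral_mono' hs fun x hx => hf (hsub hx).1⟩
  have la := lower measurableSet_Ioc hanti Ioc_subset_Icc_self Real.volume_Ioc
  have lb := lower measurableSet_Ico hbnti Ico_subset_Icc_self Real.volume_Ico
  exact ⟨key (lb.1.trans (hsplit.symm.le.trans la.2)), key (la.1.trans (hsplit.le.trans lb.2))⟩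

/-- Let the two arguments in `palmMeasure_prev_next_le` merge at `t`; continuity of the forward law
closes both inequalities. -/
theorem palmMeasure_prev_eq_next (hν : IsStationary ν) (hfin : palmMeasure ν univ ≠ ∞)
    (hcont : Continuous fun u => (palmMeasure ν).real {c | (c.points ∩ Ioc 0 u).Nonempty})
    {t : ℝ} (ht : 0 ≤ t) :
    (palmMeasure ν).real {c | (c.points ∩ Ico (-t) 0).Nonempty}
      = (palmMeasure ν).real {c | (c.points ∩ Ioc 0 t).Nonempty} := by
  have : IsFiniteMeasure (palmMeasure ν) := ⟨hfin.lt_top⟩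
  have hle : ∀ {u v : ℝ}, 0 ≤ u → u < v →
      (palmMeasure ν).real {c | (c.points ∩ Ioc 0 u).Nonempty}
        ≤ (palmMeasure ν).real {c | (c.points ∩ Ico (-v) 0).Nonempty} ∧
      (palmMeasure ν).real {c | (c.points ∩ Ico (-u) 0).Nonempty}
        ≤ (palmMeasure ν).real {c | (c.points ∩ Ioc 0 v).Nonempty} := by
    intro u v hu huv
    obtain ⟨h1, h2⟩ := palmMeasure_prev_next_le hν hfin hu huv
    have h1' := ENNReal.toReal_mono (measure_ne_top _ _) h1
    have h2' := ENNReal.toReal_mono (measure_ne_top _ _) h2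
    simp only [← measureReal_def] at h1' h2'
    rw [measureReal_compl (measurableSet_nonempty measurableSet_Ico),
      measureReal_compl (measurableSet_nonempty measurableSet_Ioc)] at h1' h2'
    exact ⟨by linarith, by linarith⟩
  apply le_antisymm
  · refine ge_of_tendsto (hcont.continuousWithinAt (s := Ioi t) (x := t)) ?_
    filter_upwards [self_mem_nhdsWithin] with v hv
    exact (hle ht hv).2
  · rcases ht.eq_or_lt with rfl | ht
    · simp
    · refine le_of_tendsto (hcont.continuousWithinAt (s := Iio t) (x := t)) ?_
      filter_upwards [Ioo_mem_nhdsLT ht] with u hu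
      exact (hle hu.1.le hu.2).1

end PointConfig

/-! ### Palm calculus for independent request processes. -/

namespace Cache

open PointConfig

variable {n : ℕ} {ν : Fin n → Measure PointConfig} [∀ i, IsProbabilityMeasure (ν i)]

theorem measurable_shift {n : ℕ} :
    Measurable fun p : (Fin n → PointConfig) × ℝ => shift p.2 p.1 :=
  measurable_pi_lambda _ fun i => PointConfig.measurable_shift.comp
    (measurable_snd.prodMk ((measurable_pi_apply i).comp measurable_fst))

theorem measurableSet_coord {n : ℕ} (i : Fin n) {A : Set PointConfig} (hA : MeasurableSet A) :
    MeasurableSet {ω : Fin n → PointConfig | ω i ∈ A} :=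
  (measurable_pi_apply (X := fun _ : Fin n => PointConfig) i) hA

/-- The Palm measure (not normalized) associated with the `i`-th request process. -/
noncomputable def palmMeasure {n : ℕ} (μ : Measure (Fin n → PointConfig)) (i : Fin n) :
    Measure (Fin n → PointConfig) :=
  (μ ⊗ₘ ((pointKernel.comap (fun ω : Fin n → PointConfig => ω i) (measurable_pi_apply i)).restrict
    (measurableSet_Ioc (a := (0 : ℝ)) (b := 1)))).map fun p => shift p.2 p.1

theorem palmMeasure_apply {n : ℕ} (μ : Measure (Fin n → PointConfig)) [SFinite μ] (i : Fin n)
    {A : Set (Fin n → PointConfig)} (hA : MeasurableSet A) : palmMeasure μ i A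
      = ∫⁻ ω, ∫⁻ x in Ioc 0 1, A.indicator 1 (shift x ω) ∂(ω i).pointMeasure ∂μ := by
  rw [← lintegral_indicator_one hA, palmMeasure,
    lintegral_map (measurable_one.indicator hA) measurable_shift,
    Measure.lintegral_compProd
      (f := fun p : (Fin n → PointConfig) × ℝ => A.indicator 1 (shift p.2 p.1))
      ((measurable_one.indicator hA).comp measurable_shift)]
  simp [Kernel.restrict_apply, Kernel.comap_apply]

theorem measurable_lintegral_shift {n : ℕ} (i : Fin n)
    {A : Set (Fin n → PointConfig)} (hA : MeasurableSet A) :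
    Measurable fun ω : Fin n → PointConfig =>
      ∫⁻ x in Ioc 0 1, A.indicator 1 (shift x ω) ∂(ω i).pointMeasure :=
  Measurable.lintegral_kernel_prod_right' (κ := (pointKernel.comap
      (fun ω : Fin n → PointConfig => ω i) (measurable_pi_apply i)).restrict
      (measurableSet_Ioc (a := (0 : ℝ)) (b := 1)))
    (f := fun p : (Fin n → PointConfig) × ℝ => A.indicator 1 (shift p.2 p.1))
    ((measurable_one.indicator hA).comp measurable_shift)

theorem palmMeasure_preimage (i : Fin n) {A : Set PointConfig} (hA : MeasurableSet A) :
    palmMeasure (Measure.pi ν) i {ω | ω i ∈ A} = PointConfig.palmMeasure (ν i) A := by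
  rw [palmMeasure_apply _ i (measurableSet_coord i hA), PointConfig.palmMeasure_apply (ν i) hA]
  have hm : Measurable fun c : PointConfig =>
      ∫⁻ x in Ioc 0 1, A.indicator 1 (c.shift x) ∂c.pointMeasure :=
    Measurable.lintegral_kernel_prod_right'
      (κ := pointKernel.restrict (measurableSet_Ioc (a := (0 : ℝ)) (b := 1)))
      (f := fun p : PointConfig × ℝ => A.indicator 1 (p.1.shift p.2))
      ((measurable_one.indicator hA).comp measurable_shift_swap)
  exact (measurePreserving_eval ν i).lintegral_comp hm

theorem palmMeasure_univ (i : Fin n) :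
    palmMeasure (Measure.pi ν) i univ = PointConfig.palmMeasure (ν i) univ :=
  palmMeasure_preimage i MeasurableSet.univ

/-- Resampling one coordinate independently preserves a product law. This separates the process that
supplies the Palm points from the remaining ones. -/
theorem measurePreserving_update (i : Fin n) :
    MeasurePreserving (fun p : PointConfig × (Fin n → PointConfig) => Function.update p.2 i p.1)
      ((ν i).prod (Measure.pi ν)) (Measure.pi ν) := by
  have hm : Measurable fun p : PointConfig × (Fin n → PointConfig) =>
      Function.update p.2 i p.1 := by
    refine measurable_pi_lambda _ fun j => ?_
    rcases eq_or_ne j i with rfl | hj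
    · simpa using measurable_fst
    · simpa [hj] using measurable_snd.eval (a := j)
  refine ⟨hm, (Measure.pi_eq fun s hs => ?_).symm⟩
  rw [Measure.map_apply hm (MeasurableSet.univ_pi hs)]
  have : (fun p : PointConfig × (Fin n → PointConfig) => Function.update p.2 i p.1) ⁻¹' univ.pi s
      = s i ×ˢ univ.pi (Function.update s i univ) := by
    ext p
    simp only [mem_preimage, mem_univ_pi, mem_prod]
    constructor
    · refine fun h => ⟨by simpa using h i, fun j => ?_⟩
      rcases eq_or_ne j i with rfl | hj
      · simp
      · simpa [hj] using h j
    · rintro ⟨h1, h2⟩ j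
      rcases eq_or_ne j i with rfl | hj
      · simpa using h1
      · simpa [hj] using h2 j
  rw [this, Measure.prod_prod, Measure.pi_pi, ← Finset.mul_prod_erase _ _ (Finset.mem_univ i),
    ← Finset.mul_prod_erase Finset.univ (fun j => ν j (s j)) (Finset.mem_univ i)]
  simp only [Function.update_self, measure_univ, one_mul]
  congr 1
  refine Finset.prod_congr rfl fun j hj => ?_
  rw [Function.update_of_ne (Finset.ne_of_mem_erase hj)]

theorem measurePreserving_shift (hν : ∀ i, IsStationary (ν i)) (t : ℝ) :
    MeasurePreserving (shift t) (Measure.pi ν) (Measure.pi ν) :=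
  measurePreserving_pi ν ν fun i => hν i t

/-- The Palm measure of the `i`-th request process leaves the law of the other ones unchanged. -/
theorem palmMeasure_of_update (hν : ∀ i, IsStationary (ν i)) (i : Fin n)
    {B : Set (Fin n → PointConfig)} (hB : MeasurableSet B)
    (hBi : ∀ ω c, Function.update ω i c ∈ B ↔ ω ∈ B) :
    palmMeasure (Measure.pi ν) i B
      = PointConfig.palmMeasure (ν i) univ * Measure.pi ν B := by
  rw [palmMeasure_apply _ i hB,
    ← (measurePreserving_update i).lintegral_comp (measurable_lintegral_shift i hB)]
  have hshift : ∀ (x : ℝ) (ω : Fin n → PointConfig) (c : PointConfig),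
      shift x (Function.update ω i c) ∈ B ↔ shift x ω ∈ B := by
    intro x ω c
    rw [← hBi (shift x ω) (c.shift x)]
    suffices shift x (Function.update ω i c) = Function.update (shift x ω) i (c.shift x) by
      rw [this]
    ext j : 1
    rcases eq_or_ne j i with rfl | hj
    · simp [shift]
    · simp [shift, hj]
  have hind : ∀ (x : ℝ) (ω : Fin n → PointConfig) (c : PointConfig),
      B.indicator (1 : (Fin n → PointConfig) → ℝ≥0∞) (shift x (Function.update ω i c))
        = B.indicator 1 (shift x ω) := by
    intro x ω c
    by_cases h : shift x ω ∈ B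
    · rw [indicator_of_mem h, indicator_of_mem ((hshift x ω c).2 h)]; rfl
    · rw [indicator_of_notMem h, indicator_of_notMem (fun h' => h ((hshift x ω c).1 h'))]
  simp only [hind, Function.update_self]
  have hm : Measurable fun q : (PointConfig × (Fin n → PointConfig)) × ℝ =>
      B.indicator (1 : (Fin n → PointConfig) → ℝ≥0∞) (shift q.2 q.1.2) :=
    (measurable_one.indicator hB).comp
      (measurable_shift.comp (measurable_fst.snd.prodMk measurable_snd))
  have hm1 : Measurable fun p : PointConfig × (Fin n → PointConfig) =>
      ∫⁻ x in Ioc 0 1, B.indicator 1 (shift x p.2) ∂p.1.pointMeasure :=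
    Measurable.lintegral_kernel_prod_right' (κ := (pointKernel.comap Prod.fst measurable_fst).restrict
      (measurableSet_Ioc (a := (0 : ℝ)) (b := 1))) hm
  rw [lintegral_prod _ hm1.aemeasurable, PointConfig.palmMeasure_univ, ← lintegral_mul_const _
    (measurable_toENNReal_count measurableSet_Ioc)]
  refine lintegral_congr fun c => ?_
  have hsf : SFinite (c.pointMeasure.restrict (Ioc 0 1)) := by
    rw [← pointKernel_apply c]; infer_instance
  simp only
  -- With the points of the `i`-th process frozen, the event seen from each point `x` has the same
  -- probability by stationarity, so only the number of points in `(0, 1]` remains.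
  rw [lintegral_lintegral_swap]
  · have hx : ∀ x : ℝ, ∫⁻ ω, B.indicator 1 (shift x ω) ∂Measure.pi ν = Measure.pi ν B := by
      intro x
      rw [(measurePreserving_shift hν x).lintegral_comp (measurable_one.indicator hB),
        lintegral_indicator_one hB]
    simp only [hx, lintegral_const, Measure.restrict_apply_univ]
    rw [pointMeasure_apply _ measurableSet_Ioc, mul_comm]
  · exact ((measurable_one.indicator hB).comp measurable_shift).aemeasurable

theorem intensity_pi (i : Fin n) :
    intensity (Measure.pi ν) (fun ω => ω i) = PointConfig.palmMeasure (ν i) univ := by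
  rw [intensity, PointConfig.palmMeasure_univ]
  exact (measurePreserving_eval ν i).lintegral_comp (measurable_toENNReal_count measurableSet_Ioc)

theorem palmProb_nextPoint (i : Fin n) (s : ℝ) :
    palmProb (Measure.pi ν) (fun ω => ω i) {ω | (ω i).nextPoint ≤ (s : EReal)}
      = PointConfig.palmMeasure (ν i) {c | (c.points ∩ Ioc 0 s).Nonempty}
        / PointConfig.palmMeasure (ν i) univ := by
  rw [palmProb, intensity_pi, ← palmMeasure_preimage i (measurableSet_nonempty measurableSet_Ioc),
    palmMeasure_apply _ i (measurableSet_coord i (measurableSet_nonempty measurableSet_Ioc))]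
  congr 1
  refine lintegral_congr fun ω => ?_
  rw [tsum_points_inter (ω i) (fun t => indicator {ω : Fin n → PointConfig |
    (ω i).nextPoint ≤ (s : EReal)} (fun _ => (1 : ℝ≥0∞)) (shift t ω)), lintegral_indicator
    measurableSet_Ioc]
  simp only [nextPoint_le_iff]
  rfl

theorem lintegral_superposition_le (ω : Fin n → PointConfig) {g : ℝ → ℝ≥0∞}
    {h : Fin n → ℝ → ℝ≥0∞}
    (hgh : ∀ x, x ∈ (superposition ω).points → ∃ i, x ∈ (ω i).points ∧ g x ≤ h i x) :
    ∫⁻ x, g x ∂(superposition ω).pointMeasure ≤ ∑ i, ∫⁻ x, h i x ∂(ω i).pointMeasure := by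
  simp_rw [lintegral_pointMeasure]
  rw [← Summable.tsum_finsetSum fun _ _ => ENNReal.summable]
  refine ENNReal.tsum_le_tsum fun x => ?_
  by_cases hx : x ∈ (superposition ω).points
  · obtain ⟨i, hi, hle⟩ := hgh x hx
    rw [indicator_of_mem hx]
    refine hle.trans ?_
    rw [← indicator_of_mem hi (h i)]
    exact Finset.single_le_sum (f := fun i => (ω i).points.indicator (h i) x)
      (fun _ _ => zero_le) (Finset.mem_univ i)
  · rw [indicator_of_notMem hx]
    exact zero_le

/-- Under the Palm measure of process `i`, process `j` keeps its stationary law and so almost surely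
has no point at 0. -/
theorem ae_disjoint_points (hν : ∀ i, IsStationary (ν i))
    (hfin : ∀ i, PointConfig.palmMeasure (ν i) univ ≠ ∞) {i j : Fin n} (hij : i ≠ j) :
    ∀ᵐ ω ∂Measure.pi ν, ∀ x ∈ Ioc (0 : ℝ) 1, x ∈ (ω i).points → x ∉ (ω j).points := by
  have h0 : MeasurableSet {c : PointConfig | (0 : ℝ) ∈ c.points} := by
    have := measurableSet_nonempty (measurableSet_singleton (0 : ℝ))
    simpa [inter_singleton_nonempty] using this
  have hB : MeasurableSet {ω : Fin n → PointConfig | (0 : ℝ) ∈ (ω j).points} :=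
    measurableSet_coord j h0
  have h := palmMeasure_of_update hν i hB (fun ω c => by simp [hij.symm])
  have hz : Measure.pi ν {ω : Fin n → PointConfig | (0 : ℝ) ∈ (ω j).points} = 0 := by
    rw [← measure_zero_mem (hν j) (hfin j), ← (measurePreserving_eval ν j).measure_preimage
      h0.nullMeasurableSet]
    rfl
  rw [hz, mul_zero, palmMeasure_apply _ i hB,
    lintegral_eq_zero_iff (measurable_lintegral_shift i hB)] at h
  filter_upwards [h] with ω hω x hx hxi hxj
  rw [Pi.zero_apply, ← lintegral_indicator measurableSet_Ioc, lintegral_pointMeasure,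
    ENNReal.tsum_eq_zero] at hω
  have := hω x
  rw [indicator_of_mem hxi, indicator_of_mem hx, indicator_of_mem] at this
  · simp at this
  · simpa [shift, mem_points_shift] using hxj

theorem intensity_superposition (hν : ∀ i, IsStationary (ν i))
    (hfin : ∀ i, PointConfig.palmMeasure (ν i) univ ≠ ∞) :
    intensity (Measure.pi ν) superposition = ∑ i, PointConfig.palmMeasure (ν i) univ := by
  have hae : ∀ᵐ ω ∂Measure.pi ν, ∀ i j : Fin n, i ≠ j → ∀ x ∈ Ioc (0 : ℝ) 1,
      x ∈ (ω i).points → x ∉ (ω j).points := by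
    simp_rw [ae_all_iff]
    exact fun i j hij => (ae_disjoint_points hν hfin hij)
  have hsum : ∀ᵐ ω ∂Measure.pi ν, ((superposition ω).count (Ioc 0 1) : ℝ≥0∞)
      = ∑ i, ((ω i).count (Ioc 0 1) : ℝ≥0∞) := by
    filter_upwards [hae] with ω hω
    simp_rw [← pointMeasure_apply _ (measurableSet_Ioc (a := (0 : ℝ)) (b := 1)), pointMeasure,
      Measure.restrict_apply (measurableSet_Ioc (a := (0 : ℝ)) (b := 1))]
    have : Ioc (0 : ℝ) 1 ∩ (superposition ω).points = ⋃ i, Ioc (0 : ℝ) 1 ∩ (ω i).points := by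
      rw [← inter_iUnion]; rfl
    rw [this, measure_iUnion _ fun i => measurableSet_Ioc.inter (ω i).measurableSet_points,
      tsum_fintype]
    intro i j hij
    exact Set.disjoint_left.2 fun x hx hx' => hω i j hij x hx.1 hx.2 hx'.2
  rw [intensity, lintegral_congr_ae hsum, lintegral_finsetSum]
  · exact Finset.sum_congr rfl fun i _ => intensity_pi i
  · exact fun i _ => (measurable_toENNReal_count measurableSet_Ioc).comp (measurable_pi_apply i)

end Cache

/-! ### Requested contents: concentration of their number, and the fill time. -/

namespace Cache

open PointConfig

variable {n : ℕ} {ν : Fin n → Measure PointConfig} [∀ i, IsProbabilityMeasure (ν i)]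

theorem rate_pi (i : Fin n) : rate (Measure.pi ν) i = (PointConfig.palmMeasure (ν i)).real univ := by
  rw [rate, intensity_pi, measureReal_def]

theorem interCdf_pi (i : Fin n) (s : ℝ) : interCdf (Measure.pi ν) i s
    = (PointConfig.palmMeasure (ν i)).real {c | (c.points ∩ Ioc 0 s).Nonempty}
      / rate (Measure.pi ν) i := by
  rw [interCdf, palmProb_nextPoint, ENNReal.toReal_div, rate_pi, measureReal_def, measureReal_def]

open Classical in
theorem requested_coe (i : Fin n) (t : ℝ) (ω : Fin n → PointConfig) :
    requested i (t : EReal) ω = if ((ω i).points ∩ Ico (-t) 0).Nonempty then 1 else 0 := by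
  rw [requested]
  congr 1
  refine propext ⟨?_, ?_⟩
  · rintro ⟨x, hx, h0, ht⟩
    exact ⟨x, hx, by linarith [EReal.coe_le_coe_iff.1 ht], h0⟩
  · rintro ⟨x, hx, h1, h0⟩
    exact ⟨x, hx, h0, EReal.coe_le_coe_iff.2 (by linarith)⟩

theorem requested_mem (i : Fin n) (t : EReal) (ω : Fin n → PointConfig) :
    requested i t ω = 0 ∨ requested i t ω = 1 := by
  rw [requested]; split_ifs <;> simp

theorem requested_nonneg (i : Fin n) (t : EReal) (ω : Fin n → PointConfig) :
    0 ≤ requested i t ω := by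
  rcases requested_mem i t ω with h | h <;> simp [h]

theorem requested_le_one (i : Fin n) (t : EReal) (ω : Fin n → PointConfig) :
    requested i t ω ≤ 1 := by
  rcases requested_mem i t ω with h | h <;> simp [h]

theorem requested_mono (i : Fin n) (ω : Fin n → PointConfig) :
    Monotone fun t => requested i t ω := by
  classical
  intro s t hst
  simp only [requested]
  split_ifs with h1 h2 <;> first | rfl | norm_num
  obtain ⟨x, hx, h0, hs⟩ := h1
  exact h2 ⟨x, hx, h0, hs.trans hst⟩

/-- The event that content `i` is requested during `[-t, 0)`. -/
noncomputable def requestedSet (i : Fin n) (t : ℝ) : Set (Fin n → PointConfig) :=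
  {ω | ω i ∈ {c : PointConfig | (c.points ∩ Ico (-t) 0).Nonempty}}

theorem measurableSet_requestedSet (i : Fin n) (t : ℝ) :
    MeasurableSet (requestedSet i t) :=
  measurableSet_coord i (measurableSet_nonempty measurableSet_Ico)

theorem requested_eq_indicator (i : Fin n) (t : ℝ) :
    requested i (t : EReal) = (requestedSet i t).indicator 1 := by
  classical
  ext ω
  rw [requested_coe, indicator_apply]
  rfl

theorem requested_eq_one_iff (i : Fin n) (t : ℝ) (ω : Fin n → PointConfig) :
    requested i (t : EReal) ω = 1 ↔ ω ∈ requestedSet i t := by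
  rw [requested_eq_indicator, indicator_eq_one_iff_mem]

theorem measurable_requested (i : Fin n) (t : ℝ) : Measurable (requested i (t : EReal)) := by
  rw [requested_eq_indicator]
  exact measurable_one.indicator (measurableSet_requestedSet i t)

/-- The probability that content `i` is requested during `[-t, 0)`. -/
noncomputable def requestProb (μ : Measure (Fin n → PointConfig)) (i : Fin n) (t : ℝ) : ℝ :=
  μ.real (requestedSet i t)

theorem integral_requested (μ : Measure (Fin n → PointConfig)) (i : Fin n) (t : ℝ) :
    ∫ ω, requested i (t : EReal) ω ∂μ = requestProb μ i t := by
  rw [requested_eq_indicator, integral_indicator_one (measurableSet_requestedSet i t), requestProb]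

theorem memLp_requested (μ : Measure (Fin n → PointConfig)) [IsFiniteMeasure μ] (i : Fin n)
    (t : ℝ) (p : ℝ≥0∞) : MemLp (requested i (t : EReal)) p μ :=
  MemLp.of_bound (measurable_requested i t).aestronglyMeasurable 1 (Eventually.of_forall fun ω => by
    rw [Real.norm_of_nonneg (requested_nonneg _ _ _)]; exact requested_le_one _ _ _)

theorem integrable_requested (μ : Measure (Fin n → PointConfig)) [IsFiniteMeasure μ] (i : Fin n)
    (t : ℝ) : Integrable (requested i (t : EReal)) μ :=
  (memLp_requested μ i t 1).integrable le_rfl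

theorem expectedSize_eq (μ : Measure (Fin n → PointConfig)) [IsFiniteMeasure μ] (t : ℝ) :
    expectedSize μ t = ∑ i, requestProb μ i t := by
  simp only [expectedSize, numRequested]
  rw [integral_finsetSum _ fun i _ => integrable_requested μ i t]
  simp_rw [integral_requested]

/-- The number of contents other than `i` requested during `[-t, 0)`. -/
noncomputable def othersRequested (i : Fin n) (t : EReal) (ω : Fin n → PointConfig) : ℝ :=
  ∑ j ∈ Finset.univ.erase i, requested j t ω

theorem numRequested_eq_add (i : Fin n) (t : EReal) (ω : Fin n → PointConfig) :
    numRequested t ω = requested i t ω + othersRequested i t ω :=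
  (Finset.add_sum_erase _ _ (Finset.mem_univ i)).symm

theorem measurable_othersRequested (i : Fin n) (t : ℝ) :
    Measurable (othersRequested i (t : EReal)) :=
  Finset.measurable_fun_sum _ fun j _ => measurable_requested j t

theorem othersRequested_update (i : Fin n) (t : EReal) (ω : Fin n → PointConfig)
    (c : PointConfig) : othersRequested i t (Function.update ω i c) = othersRequested i t ω := by
  refine Finset.sum_congr rfl fun j hj => ?_
  rw [requested, requested, Function.update_of_ne (Finset.ne_of_mem_erase hj)]

theorem integral_othersRequested (μ : Measure (Fin n → PointConfig)) [IsFiniteMeasure μ]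
    (i : Fin n) (t : ℝ) :
    ∫ ω, othersRequested i (t : EReal) ω ∂μ = expectedSize μ t - requestProb μ i t := by
  simp only [othersRequested]
  rw [integral_finsetSum _ fun i _ => integrable_requested μ i t, expectedSize_eq,
    ← Finset.add_sum_erase _ _ (Finset.mem_univ i)]
  simp_rw [integral_requested]
  ring

/-- Variances of independent indicators add, and each is at most the corresponding probability. -/
theorem variance_othersRequested_le (i : Fin n) (t : ℝ) :
    variance (othersRequested i (t : EReal)) (Measure.pi ν) ≤ expectedSize (Measure.pi ν) t := by
  have hind : iIndepFun (fun j : Fin n => requested j (t : EReal)) (Measure.pi ν) := by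
    have hm : ∀ j : Fin n, Measurable
        ({c : PointConfig | (c.points ∩ Ico (-t) 0).Nonempty}.indicator (1 : PointConfig → ℝ)) :=
      fun j => measurable_one.indicator (measurableSet_nonempty measurableSet_Ico)
    have h := iIndepFun_pi (μ := ν) (X := fun _ =>
      {c : PointConfig | (c.points ∩ Ico (-t) 0).Nonempty}.indicator (1 : PointConfig → ℝ))
      fun j => (hm j).aemeasurable
    convert h using 2 with j
    rw [requested_eq_indicator]
    rfl
  have hsum : othersRequested i (t : EReal)
      = ∑ j ∈ Finset.univ.erase i, requested j (t : EReal) := by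
    ext ω; simp [othersRequested]
  rw [hsum, IndepFun.variance_sum (fun j _ => memLp_requested _ j t 2)
    (fun j _ k _ hjk => hind.indepFun hjk), expectedSize_eq]
  refine (Finset.sum_le_sum fun j _ => ?_).trans (Finset.sum_le_sum_of_subset_of_nonneg
    (Finset.erase_subset i Finset.univ) fun j _ _ => measureReal_nonneg)
  refine (variance_le_expectation_sq (measurable_requested j t).aestronglyMeasurable).trans_eq ?_
  rw [← integral_requested]
  refine integral_congr_ae (Eventually.of_forall fun ω => ?_)
  rcases requested_mem j t ω with h | h <;> simp [h]

theorem measureReal_othersRequested_ge (i : Fin n) {t c d : ℝ} (hd : 0 < d)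
    (hc : expectedSize (Measure.pi ν) t + d ≤ c) :
    (Measure.pi ν).real {ω | c ≤ othersRequested i (t : EReal) ω}
      ≤ expectedSize (Measure.pi ν) t / d ^ 2 := by
  have hmem : MemLp (othersRequested i (t : EReal)) 2 (Measure.pi ν) :=
    memLp_finsetSum _ fun j _ => memLp_requested _ j t 2
  have h := meas_ge_le_variance_div_sq hmem hd
  refine (ENNReal.toReal_le_of_le_ofReal 
    (div_nonneg (variance_nonneg _ _) (sq_nonneg _)) ((measure_mono ?_).trans h)).trans ?_
  · intro ω hω
    have h1 : 0 ≤ requestProb (Measure.pi ν) i t := measureReal_nonneg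
    rw [mem_ofPred_eq] at hω ⊢
    rw [integral_othersRequested]
    exact le_trans (by linarith) (le_abs_self _)
  · gcongr
    exact variance_othersRequested_le i t

/-- Chebyshev again; the extra 1 pays for leaving out content `i`, which lowers the mean by at most
1. -/
theorem measureReal_othersRequested_lt (i : Fin n) {t c d : ℝ} (hd : 0 < d)
    (hc : c + d + 1 ≤ expectedSize (Measure.pi ν) t) :
    (Measure.pi ν).real {ω | othersRequested i (t : EReal) ω < c}
      ≤ expectedSize (Measure.pi ν) t / d ^ 2 := by
  have hmem : MemLp (othersRequested i (t : EReal)) 2 (Measure.pi ν) :=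
    memLp_finsetSum _ fun j _ => memLp_requested _ j t 2
  have h := meas_ge_le_variance_div_sq hmem hd
  refine (ENNReal.toReal_le_of_le_ofReal 
    (div_nonneg (variance_nonneg _ _) (sq_nonneg _)) ((measure_mono ?_).trans h)).trans ?_
  · intro ω hω
    have h1 : requestProb (Measure.pi ν) i t ≤ 1 := measureReal_le_one
    rw [mem_ofPred_eq] at hω ⊢
    rw [integral_othersRequested, abs_sub_comm]
    exact le_trans (by linarith) (le_abs_self _)
  · gcongr
    exact variance_othersRequested_le i t

/-- If the other contents alone fill the cache by age `t`, then the fill time is at most `t`, and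
presence at the fill time implies presence at `t`. -/
theorem requested_of_requested_fillTime {i : Fin n} {c t : ℝ} {ω : Fin n → PointConfig}
    (h : requested i (fillTime c ω) ω = 1) :
    ω ∈ requestedSet i t ∨ othersRequested i (t : EReal) ω < c := by
  classical
  by_contra! hcon
  obtain ⟨h1, h2⟩ := hcon
  have hle : fillTime c ω ≤ (t : EReal) := sInf_le (by
    rw [mem_ofPred_eq, numRequested_eq_add i]
    linarith [requested_nonneg i t ω])
  have := requested_mono i ω hle
  simp only at this
  rw [h] at this
  exact h1 ((requested_eq_one_iff i t ω).1 (le_antisymm (requested_le_one _ _ _) this))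

/-- Suppose `i` was last requested at `m` in `[-t, 0)` but is absent at the fill time. Then the fill
time is below `-m`, so the cache is full at some age `s < -m` at which `i` does not yet count. The
others alone reach `c` by `s`, hence by `t`. -/
theorem not_requested_of_not_requested_fillTime {i : Fin n} {c t : ℝ} {ω : Fin n → PointConfig}
    (h : requested i (fillTime c ω) ω ≠ 1) :
    ω ∉ requestedSet i t ∨ c ≤ othersRequested i (t : EReal) ω := by
  classical
  by_contra! hcon
  obtain ⟨hne, h2⟩ := hcon
  have hfin : ((ω i).points ∩ Ico (-t) 0).Finite :=
    ((ω i).locallyFinite (-t) 0).subset (inter_subset_inter_right _ Ico_subset_Icc_self)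
  obtain ⟨m, hm, hmax⟩ := hfin.exists_maximal hne
  have hlt : fillTime c ω < ((-m : ℝ) : EReal) := by
    by_contra! hge
    refine h ?_
    rw [requested, if_pos ⟨m, hm.1, hm.2.2, hge⟩]
  obtain ⟨s, hs, hsm⟩ := sInf_lt_iff.1 hlt
  rw [mem_ofPred_eq, numRequested_eq_add i] at hs
  have h0 : requested i s ω = 0 := by
    rw [requested, if_neg]
    rintro ⟨x, hx, hx0, hxs⟩
    have hmx : m < x := by
      have := EReal.coe_lt_coe_iff.1 (hxs.trans_lt hsm)
      linarith
    have := hmax (y := x) ⟨hx, by linarith [hm.2.1], hx0⟩ hmx.le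
    linarith
  have hst : s ≤ (t : EReal) := hsm.le.trans (EReal.coe_le_coe_iff.2 (by linarith [hm.2.1]))
  have hmono : othersRequested i s ω ≤ othersRequested i t ω :=
    Finset.sum_le_sum fun j _ => requested_mono j ω hst
  linarith

end Cache

/-! ### Palm probabilities of the superposition, content by content. -/

namespace Cache

open PointConfig

variable {n : ℕ} {ν : Fin n → Measure PointConfig} [∀ i, IsProbabilityMeasure (ν i)]

theorem palmMeasure_real_univ (i : Fin n) :
    (palmMeasure (Measure.pi ν) i).real univ = rate (Measure.pi ν) i := by
  rw [measureReal_def, palmMeasure_univ, rate_pi, measureReal_def]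

theorem interCdf_nonneg (μ : Measure (Fin n → PointConfig)) (i : Fin n) (s : ℝ) :
    0 ≤ interCdf μ i s := ENNReal.toReal_nonneg

/-- Each superposed point where `A` occurs is charged to a content that has that point and whose
event `E i` occurs. The set `A` may be non-measurable, which avoids proving measurability of the LRU
hit event. -/
theorem tsum_superposition_le {A : Set (Fin n → PointConfig)}
    {E : Fin n → Set (Fin n → PointConfig)}
    (hAE : ∀ ω : Fin n → PointConfig, (∃ i, (0 : ℝ) ∈ (ω i).points) → ω ∈ A →
      ∃ i, (0 : ℝ) ∈ (ω i).points ∧ ω ∈ E i) (ω : Fin n → PointConfig) :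
    ∑' t : ↥((superposition ω).points ∩ Ioc 0 1),
        A.indicator (fun _ => (1 : ℝ≥0∞)) (shift t.1 ω)
      ≤ ∑ i, ∫⁻ x in Ioc 0 1, (E i).indicator 1 (shift x ω) ∂(ω i).pointMeasure := by
  rw [tsum_points_inter (superposition ω) (fun t => A.indicator (fun _ => 1) (shift t ω))]
  refine le_trans (lintegral_superposition_le ω
    (h := fun i => (Ioc 0 1).indicator fun x => (E i).indicator 1 (shift x ω)) fun x hx => ?_)
    (Finset.sum_le_sum fun i _ => (lintegral_indicator measurableSet_Ioc _).le)
  obtain ⟨j, hj⟩ := mem_iUnion.1 hx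
  by_cases hxA : x ∈ Ioc (0 : ℝ) 1 ∧ shift x ω ∈ A
  · obtain ⟨i, hi0, hiE⟩ := hAE (shift x ω) ⟨j, by simpa [shift, mem_points_shift] using hj⟩ hxA.2
    refine ⟨i, by simpa [shift, mem_points_shift] using hi0, ?_⟩
    rw [indicator_of_mem hxA.1, indicator_of_mem hxA.1, indicator_of_mem hxA.2,
      indicator_of_mem hiE]
    rfl
  · refine ⟨j, hj, ?_⟩
    by_cases h1 : x ∈ Ioc (0 : ℝ) 1
    · rw [indicator_of_mem h1, indicator_of_notMem fun h2 => hxA ⟨h1, h2⟩]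
      exact zero_le
    · rw [indicator_of_notMem h1]
      exact zero_le

section

variable (hfin : ∀ i, PointConfig.palmMeasure (ν i) univ ≠ ∞)
include hfin

theorem isFiniteMeasure_palmMeasure (i : Fin n) : IsFiniteMeasure (palmMeasure (Measure.pi ν) i) :=
  ⟨by rw [palmMeasure_univ]; exact (hfin i).lt_top⟩

theorem interCdf_le_one (i : Fin n) (s : ℝ) : interCdf (Measure.pi ν) i s ≤ 1 := by
  have : IsFiniteMeasure (PointConfig.palmMeasure (ν i)) := ⟨(hfin i).lt_top⟩
  rw [interCdf_pi, rate_pi]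
  exact div_le_one_of_le₀ (measureReal_mono (subset_univ _)) measureReal_nonneg

theorem interCdf_mono (i : Fin n) : Monotone (interCdf (Measure.pi ν) i) := by
  have : IsFiniteMeasure (PointConfig.palmMeasure (ν i)) := ⟨(hfin i).lt_top⟩
  intro s t hst
  rw [interCdf_pi, interCdf_pi]
  refine div_le_div_of_nonneg_right (measureReal_mono fun c hc => hc.mono
    (inter_subset_inter_right _ (Ioc_subset_Ioc_right hst))) ?_
  rw [rate_pi]
  exact measureReal_nonneg

/-- Under the Palm probability, the time since the last request and the time until the next one
have the same law. -/
theorem palmMeasure_requestedSet (hν : ∀ i, IsStationary (ν i)) {i : Fin n}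
    (hpos : 0 < rate (Measure.pi ν) i)
    (hG : Continuous (interCdf (Measure.pi ν) i)) {t : ℝ} (ht : 0 ≤ t) :
    (palmMeasure (Measure.pi ν) i).real (requestedSet i t)
      = rate (Measure.pi ν) i * interCdf (Measure.pi ν) i t := by
  have h1 : ∀ u, (PointConfig.palmMeasure (ν i)).real {c | (c.points ∩ Ioc 0 u).Nonempty}
      = rate (Measure.pi ν) i * interCdf (Measure.pi ν) i u := by
    intro u
    rw [interCdf_pi, mul_div_cancel₀ _ hpos.ne']
  rw [← h1, ← palmMeasure_prev_eq_next (hν i) (hfin i) (by simp_rw [h1]; exact hG.const_mul _) ht,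
    measureReal_def, measureReal_def, requestedSet, palmMeasure_preimage i
      (measurableSet_nonempty measurableSet_Ico)]

/-- The forward inversion formula with time rescaled by the rate. It makes the survival integral of
each scaled cdf a probability. -/
theorem requestProb_eq_integral (hν : ∀ i, IsStationary (ν i)) {i : Fin n}
    (hpos : 0 < rate (Measure.pi ν) i) {t : ℝ} (ht : 0 ≤ t) :
    requestProb (Measure.pi ν) i t
      = ∫ x in (0 : ℝ)..(rate (Measure.pi ν) i * t), (1 - scaledCdf (Measure.pi ν) i x) := by
  have : IsFiniteMeasure (PointConfig.palmMeasure (ν i)) := ⟨(hfin i).lt_top⟩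
  set r := rate (Measure.pi ν) i with hr
  have hint : ∀ a b, IntervalIntegrable (fun u => r * (1 - interCdf (Measure.pi ν) i u))
      volume a b := fun a b => by
    have := ((interCdf_mono hfin i).intervalIntegrable (μ := volume) (a := a) (b := b))
    exact (intervalIntegrable_const.sub this).const_mul r
  have h1 : ν i {c | (c.points ∩ Ico (-t) 0).Nonempty}
      = ENNReal.ofReal (∫ u in (0 : ℝ)..t, r * (1 - interCdf (Measure.pi ν) i u)) := by
    rw [measure_nonempty_eq_lintegral_next (hν i) (hfin i), intervalIntegral.integral_of_le ht,
      ofReal_integral_eq_lintegral_ofReal]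
    · refine lintegral_congr fun u => ?_
      rw [← ofReal_measureReal (h := measure_ne_top _ _),
        measureReal_compl (measurableSet_nonempty measurableSet_Ioc), mul_sub, mul_one, interCdf_pi,
        ← hr, mul_div_cancel₀ _ hpos.ne', hr, rate_pi]
    · exact (hint 0 t).1
    · exact Eventually.of_forall fun u =>
        mul_nonneg hpos.le (sub_nonneg.2 (interCdf_le_one hfin i u))
  have h2 : requestProb (Measure.pi ν) i t = (ν i).real {c | (c.points ∩ Ico (-t) 0).Nonempty} := by
    rw [requestProb, measureReal_def, measureReal_def, ← (measurePreserving_eval ν i).measure_preimage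
      (measurableSet_nonempty measurableSet_Ico).nullMeasurableSet]
    rfl
  rw [h2, measureReal_def, h1, ENNReal.toReal_ofReal]
  · rw [intervalIntegral.integral_const_mul]
    have := intervalIntegral.smul_integral_comp_mul_left (a := 0) (b := t)
      (fun x => 1 - scaledCdf (Measure.pi ν) i x) r
    rw [mul_zero, smul_eq_mul] at this
    rw [← this]
    congr 1
    refine intervalIntegral.integral_congr fun u _ => ?_
    simp only [scaledCdf, ← hr]
    rw [mul_div_cancel_left₀ _ hpos.ne']
  · exact intervalIntegral.integral_nonneg ht fun u _ =>
        mul_nonneg hpos.le (sub_nonneg.2 (interCdf_le_one hfin i u))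

theorem intensity_superposition_toReal (hν : ∀ i, IsStationary (ν i)) :
    (intensity (Measure.pi ν) superposition).toReal = ∑ i, rate (Measure.pi ν) i := by
  rw [intensity_superposition hν hfin, ENNReal.toReal_sum fun i _ => hfin i]
  simp_rw [rate_pi, measureReal_def]

theorem ofReal_sum_palmMeasure {E : Fin n → Set (Fin n → PointConfig)}
    (hE : ∀ i, MeasurableSet (E i)) :
    ENNReal.ofReal (∑ i, (palmMeasure (Measure.pi ν) i).real (E i))
      = ∫⁻ ω, ∑ i, ∫⁻ x in Ioc 0 1, (E i).indicator 1 (shift x ω) ∂(ω i).pointMeasure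
          ∂Measure.pi ν := by
  rw [ENNReal.ofReal_sum_of_nonneg fun _ _ => measureReal_nonneg,
    lintegral_finsetSum _ fun i _ => measurable_lintegral_shift i (hE i)]
  refine Finset.sum_congr rfl fun i _ => ?_
  have := isFiniteMeasure_palmMeasure hfin i
  rw [← palmMeasure_apply _ i (hE i), ofReal_measureReal (h := measure_ne_top _ _)]

theorem lintegral_tsum_superposition_le {A : Set (Fin n → PointConfig)}
    {E : Fin n → Set (Fin n → PointConfig)} (hE : ∀ i, MeasurableSet (E i))
    (hAE : ∀ ω : Fin n → PointConfig, (∃ i, (0 : ℝ) ∈ (ω i).points) → ω ∈ A →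
      ∃ i, (0 : ℝ) ∈ (ω i).points ∧ ω ∈ E i) :
    ∫⁻ ω, ∑' t : ↥((superposition ω).points ∩ Ioc 0 1),
        A.indicator (fun _ => (1 : ℝ≥0∞)) (shift t.1 ω) ∂Measure.pi ν
      ≤ ENNReal.ofReal (∑ i, (palmMeasure (Measure.pi ν) i).real (E i)) := by
  rw [ofReal_sum_palmMeasure hfin hE]
  exact lintegral_mono fun ω => tsum_superposition_le hAE ω

theorem palmProb_superposition_le (hν : ∀ i, IsStationary (ν i))
    {A : Set (Fin n → PointConfig)}
    {E : Fin n → Set (Fin n → PointConfig)} (hE : ∀ i, MeasurableSet (E i))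
    (hAE : ∀ ω : Fin n → PointConfig, (∃ i, (0 : ℝ) ∈ (ω i).points) → ω ∈ A →
      ∃ i, (0 : ℝ) ∈ (ω i).points ∧ ω ∈ E i) :
    (palmProb (Measure.pi ν) superposition A).toReal
      ≤ (∑ i, (palmMeasure (Measure.pi ν) i).real (E i)) / ∑ i, rate (Measure.pi ν) i := by
  rw [palmProb, ENNReal.toReal_div, intensity_superposition_toReal hfin hν]
  refine div_le_div_of_nonneg_right ?_ (Finset.sum_nonneg fun i _ => ENNReal.toReal_nonneg)
  exact ENNReal.toReal_le_of_le_ofReal (Finset.sum_nonneg fun i _ => measureReal_nonneg)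
    (lintegral_tsum_superposition_le hfin hE hAE)

/-- The complement is bounded from above and subtracted from the total intensity, the `E i` covering
the failures of `A`. -/
theorem le_palmProb_superposition (hν : ∀ i, IsStationary (ν i))
    {A : Set (Fin n → PointConfig)}
    {E : Fin n → Set (Fin n → PointConfig)} (hE : ∀ i, MeasurableSet (E i))
    (hAE : ∀ ω : Fin n → PointConfig, (∃ i, (0 : ℝ) ∈ (ω i).points) → ω ∉ A →
      ∃ i, (0 : ℝ) ∈ (ω i).points ∧ ω ∈ E i) :
    (∑ i, rate (Measure.pi ν) i - ∑ i, (palmMeasure (Measure.pi ν) i).real (E i))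
        / ∑ i, rate (Measure.pi ν) i
      ≤ (palmProb (Measure.pi ν) superposition A).toReal := by
  rw [palmProb, ENNReal.toReal_div, intensity_superposition_toReal hfin hν]
  refine div_le_div_of_nonneg_right ?_ (Finset.sum_nonneg fun i _ => ENNReal.toReal_nonneg)
  set a := ∫⁻ ω, ∑' t : ↥((superposition ω).points ∩ Ioc 0 1),
        A.indicator (fun _ => (1 : ℝ≥0∞)) (shift t.1 ω) ∂Measure.pi ν with ha
  -- Additivity of the lower integral needs only one measurable summand, and the sum over the `E i`
  -- provides it.
  have hint : intensity (Measure.pi ν) superposition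
      ≤ a + ENNReal.ofReal (∑ i, (palmMeasure (Measure.pi ν) i).real (E i)) := by
    rw [ofReal_sum_palmMeasure hfin hE, ha,
      ← lintegral_add_right _ (Finset.measurable_fun_sum _ fun i _ =>
        measurable_lintegral_shift i (hE i)), intensity]
    refine lintegral_mono fun ω => ?_
    have hsplit : ((superposition ω).count (Ioc 0 1) : ℝ≥0∞)
        = (∑' t : ↥((superposition ω).points ∩ Ioc 0 1),
            A.indicator (fun _ => (1 : ℝ≥0∞)) (shift t.1 ω))
          + ∑' t : ↥((superposition ω).points ∩ Ioc 0 1),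
            Aᶜ.indicator (fun _ => (1 : ℝ≥0∞)) (shift t.1 ω) := by
      rw [← ENNReal.tsum_add]
      simp_rw [indicator_self_add_compl_apply]
      rw [ENNReal.tsum_set_one]
      rfl
    simp only
    rw [hsplit]
    exact add_le_add le_rfl (tsum_superposition_le (A := Aᶜ) hAE ω)
  have hafin : a ≠ ∞ := by
    refine ne_top_of_le_ne_top ENNReal.ofReal_ne_top (lintegral_tsum_superposition_le hfin
      (E := fun _ => univ) (fun _ => MeasurableSet.univ) fun ω h _ => ?_)
    obtain ⟨i, hi⟩ := h
    exact ⟨i, hi, trivial⟩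
  have := ENNReal.toReal_mono (ENNReal.add_ne_top.2 ⟨hafin, ENNReal.ofReal_ne_top⟩) hint
  rw [intensity_superposition_toReal hfin hν, ENNReal.toReal_add hafin ENNReal.ofReal_ne_top,
    ENNReal.toReal_ofReal (Finset.sum_nonneg fun _ _ => measureReal_nonneg)] at this
  linarith

end

end Cache

/-! ### Comparing LRU with TTL caches at two deterministic timers. -/

namespace Cache

open PointConfig

variable {n : ℕ} {ν : Fin n → Measure PointConfig} [∀ i, IsProbabilityMeasure (ν i)]

/-- The hit probability of a TTL cache in terms of the inter-request cdfs. -/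
noncomputable def meanCdf (μ : Measure (Fin n → PointConfig)) (t : ℝ) : ℝ :=
  ∑ i, popularity μ i * interCdf μ i t

theorem popularity_nonneg (μ : Measure (Fin n → PointConfig)) (i : Fin n) : 0 ≤ popularity μ i :=
  div_nonneg ENNReal.toReal_nonneg (Finset.sum_nonneg fun _ _ => ENNReal.toReal_nonneg)

theorem sum_popularity {μ : Measure (Fin n → PointConfig)} (h : 0 < ∑ i, rate μ i) :
    ∑ i, popularity μ i = 1 := by
  simp_rw [popularity]
  rw [← Finset.sum_div, div_self h.ne']

theorem palmMeasure_real_of_update (hν : ∀ i, IsStationary (ν i)) {i : Fin n}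
    {B : Set (Fin n → PointConfig)} (hB : MeasurableSet B)
    (hBi : ∀ ω c, Function.update ω i c ∈ B ↔ ω ∈ B) :
    (palmMeasure (Measure.pi ν) i).real B = rate (Measure.pi ν) i * (Measure.pi ν).real B := by
  rw [measureReal_def, palmMeasure_of_update hν i hB hBi, ENNReal.toReal_mul, rate_pi,
    measureReal_def, measureReal_def]

section

variable (hν : ∀ i, IsStationary (ν i))
  (hfin : ∀ i, PointConfig.palmMeasure (ν i) univ ≠ ∞)
  (hpos : ∀ i, 0 < rate (Measure.pi ν) i)
  (hG : ∀ i, Continuous (interCdf (Measure.pi ν) i))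
include hν hfin hpos hG

/-- The exceptional event `B` ignores process `i`, so its Palm probability is its ordinary one; the
age of `i` contributes the cdf term. -/
theorem palmMeasure_union_le {i : Fin n} {t ε : ℝ} (ht : 0 ≤ t)
    {B : Set (Fin n → PointConfig)} (hB : MeasurableSet B)
    (hBi : ∀ ω c, Function.update ω i c ∈ B ↔ ω ∈ B) (hε : (Measure.pi ν).real B ≤ ε) :
    (palmMeasure (Measure.pi ν) i).real (requestedSet i t ∪ B)
        ≤ rate (Measure.pi ν) i * (interCdf (Measure.pi ν) i t + ε) ∧
      (palmMeasure (Measure.pi ν) i).real ((requestedSet i t)ᶜ ∪ B)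
        ≤ rate (Measure.pi ν) i * (1 - interCdf (Measure.pi ν) i t + ε) := by
  have := isFiniteMeasure_palmMeasure hfin i
  have h1 := palmMeasure_requestedSet hfin hν (hpos i) (hG i) ht
  have h2 : (palmMeasure (Measure.pi ν) i).real B ≤ rate (Measure.pi ν) i * ε := by
    rw [palmMeasure_real_of_update hν hB hBi]
    exact mul_le_mul_of_nonneg_left hε (hpos i).le
  constructor
  · refine (measureReal_union_le _ _).trans ?_
    rw [h1]
    linarith
  · refine (measureReal_union_le _ _).trans ?_
    rw [measureReal_compl (measurableSet_requestedSet i t), h1, palmMeasure_real_univ]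
    linarith

theorem palmProb_le_meanCdf_add (hn : 0 < ∑ i, rate (Measure.pi ν) i) {t ε : ℝ} (ht : 0 ≤ t)
    {R B : Fin n → Set (Fin n → PointConfig)} (hB : ∀ i, MeasurableSet (B i))
    (hBi : ∀ i ω c, Function.update ω i c ∈ B i ↔ ω ∈ B i)
    (hε : ∀ i, (Measure.pi ν).real (B i) ≤ ε)
    (hR : ∀ i, R i ⊆ requestedSet i t ∪ B i) :
    (palmProb (Measure.pi ν) superposition {ω | ∃ i, 0 ∈ (ω i).points ∧ ω ∈ R i}).toReal
      ≤ meanCdf (Measure.pi ν) t + ε := by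
  refine (palmProb_superposition_le hfin hν (E := fun i => requestedSet i t ∪ B i)
    (fun i => (measurableSet_requestedSet i t).union (hB i)) ?_).trans ?_
  · rintro ω - ⟨i, hi, hiR⟩
    exact ⟨i, hi, hR i hiR⟩
  · rw [div_le_iff₀ hn]
    refine (Finset.sum_le_sum fun i _ =>
      (palmMeasure_union_le hν hfin hpos hG ht (hB i) (hBi i) (hε i)).1).trans_eq ?_
    rw [add_mul, meanCdf, Finset.sum_mul, Finset.mul_sum, ← Finset.sum_add_distrib]
    refine Finset.sum_congr rfl fun i _ => ?_
    rw [popularity]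
    field_simp

theorem meanCdf_sub_le_palmProb (hn : 0 < ∑ i, rate (Measure.pi ν) i) {t ε : ℝ} (ht : 0 ≤ t)
    {R B : Fin n → Set (Fin n → PointConfig)} (hB : ∀ i, MeasurableSet (B i))
    (hBi : ∀ i ω c, Function.update ω i c ∈ B i ↔ ω ∈ B i)
    (hε : ∀ i, (Measure.pi ν).real (B i) ≤ ε)
    (hR : ∀ i, (R i)ᶜ ⊆ (requestedSet i t)ᶜ ∪ B i) :
    meanCdf (Measure.pi ν) t - ε
      ≤ (palmProb (Measure.pi ν) superposition {ω | ∃ i, 0 ∈ (ω i).points ∧ ω ∈ R i}).toReal := by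
  refine le_trans ?_ (le_palmProb_superposition hfin hν (E := fun i => (requestedSet i t)ᶜ ∪ B i)
    (fun i => (measurableSet_requestedSet i t).compl.union (hB i)) ?_)
  · rw [le_div_iff₀ hn]
    have h := Finset.sum_le_sum fun i (_ : i ∈ Finset.univ) =>
      (palmMeasure_union_le hν hfin hpos hG ht (hB i) (hBi i) (hε i)).2
    have h2 : ∑ i, rate (Measure.pi ν) i * (1 - interCdf (Measure.pi ν) i t + ε)
        = ∑ i, rate (Measure.pi ν) i
          - (meanCdf (Measure.pi ν) t - ε) * ∑ i, rate (Measure.pi ν) i := by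
      rw [sub_mul, meanCdf, Finset.sum_mul, Finset.mul_sum, ← Finset.sum_sub_distrib,
        ← Finset.sum_sub_distrib]
      refine Finset.sum_congr rfl fun i _ => ?_
      rw [popularity]
      field_simp
      ring
    linarith
  · rintro ω ⟨i, hi⟩ hA
    exact ⟨i, hi, hR i fun hiR => hA ⟨i, hi, hiR⟩⟩

theorem hitTTL_eq_meanCdf (hn : 0 < ∑ i, rate (Measure.pi ν) i) {t : ℝ} (ht : 0 ≤ t) :
    hitTTL (Measure.pi ν) t = meanCdf (Measure.pi ν) t := by
  have hR : ∀ i : Fin n, {ω : Fin n → PointConfig | requested i (t : EReal) ω = 1}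
      = requestedSet i t := fun i => ext fun ω => requested_eq_one_iff i t ω
  apply le_antisymm
  · have := palmProb_le_meanCdf_add hν hfin hpos hG hn ht (B := fun _ => ∅) (ε := 0)
      (R := fun i => {ω | requested i (t : EReal) ω = 1})
      (fun _ => MeasurableSet.empty) (by simp) (by simp) (fun i => by simp [hR])
    rw [add_zero] at this
    exact this
  · have := meanCdf_sub_le_palmProb hν hfin hpos hG hn ht (B := fun _ => ∅) (ε := 0)
      (R := fun i => {ω | requested i (t : EReal) ω = 1})
      (fun _ => MeasurableSet.empty) (by simp) (by simp) (fun i => by simp [hR])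
    rw [sub_zero] at this
    exact this

/-- Apart from an event of small probability concerning the other contents, an LRU hit implies a TTL
hit at `t₂` and is implied by a TTL hit at `t₁`. -/
theorem abs_hitLRU_sub_hitTTL_le (hn : 0 < ∑ i, rate (Measure.pi ν) i) {c δ t₁ t t₂ : ℝ}
    (ht₁ : 0 ≤ t₁) (h1 : t₁ ≤ t) (h2 : t ≤ t₂) (hδ : 0 < δ) (hδ1 : δ ≤ 1) (hc : 2 ≤ δ * c)
    (hK₁ : expectedSize (Measure.pi ν) t₁ = (1 - δ) * c)
    (hK₂ : expectedSize (Measure.pi ν) t₂ = (1 + δ) * c) :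
    |hitLRU (Measure.pi ν) c - hitTTL (Measure.pi ν) t|
      ≤ meanCdf (Measure.pi ν) t₂ - meanCdf (Measure.pi ν) t₁ + 8 / (δ ^ 2 * c) := by
  have hc0 : 0 < c := by
    by_contra! h
    nlinarith
  have hmono : Monotone (meanCdf (Measure.pi ν)) := fun s t hst =>
    Finset.sum_le_sum fun i _ =>
      mul_le_mul_of_nonneg_left (interCdf_mono hfin i hst) (popularity_nonneg _ i)
  have hup : hitLRU (Measure.pi ν) c ≤ meanCdf (Measure.pi ν) t₂ + 8 / (δ ^ 2 * c) := by
    refine palmProb_le_meanCdf_add hν hfin hpos hG hn (ht₁.trans (h1.trans h2))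
      (B := fun i => {ω | othersRequested i (t₂ : EReal) ω < c})
      (R := fun i => {ω | requested i (fillTime c ω) ω = 1})
      (fun i => measurableSet_lt (measurable_othersRequested i t₂) measurable_const)
      (fun i ω c' => by simp [othersRequested_update]) (fun i => ?_)
      (fun i ω hω => requested_of_requested_fillTime hω)
    -- Of the surplus `δ c`, half is the deviation `d` and the other half, at least 1, covers the
    -- omitted content. The bound `4 (1 + δ) / (δ² c)` gives the constant 8.
    refine (measureReal_othersRequested_lt i (d := δ * c / 2) (by positivity) ?_).trans ?_
    · rw [hK₂]; linarith
    · rw [hK₂, div_le_div_iff₀ (by positivity) (by positivity)]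
      nlinarith [mul_pos (mul_pos hδ hδ) (mul_pos hc0 hc0),
        mul_nonneg (mul_pos (mul_pos hδ hδ) (mul_pos hc0 hc0)).le (sub_nonneg.2 hδ1)]
  have hlo : meanCdf (Measure.pi ν) t₁ - 8 / (δ ^ 2 * c) ≤ hitLRU (Measure.pi ν) c := by
    refine meanCdf_sub_le_palmProb hν hfin hpos hG hn ht₁
      (B := fun i => {ω | c ≤ othersRequested i (t₁ : EReal) ω})
      (R := fun i => {ω | requested i (fillTime c ω) ω = 1})
      (fun i => measurableSet_le measurable_const (measurable_othersRequested i t₁))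
      (fun i ω c' => by simp [othersRequested_update]) (fun i => ?_)
      (fun i ω hω => not_requested_of_not_requested_fillTime hω)
    refine (measureReal_othersRequested_ge i (d := δ * c) (by positivity) ?_).trans ?_
    · rw [hK₁]; linarith
    · rw [hK₁, div_le_div_iff₀ (by positivity) (by positivity)]
      nlinarith [mul_pos (mul_pos hδ hδ) (mul_pos hc0 hc0),
        mul_nonneg (mul_pos (mul_pos hδ hδ) (mul_pos hc0 hc0)).le hδ.le]
  rw [hitTTL_eq_meanCdf hν hfin hpos hG hn (ht₁.trans h1), abs_le]
  constructor <;> linarith [hmono h1, hmono h2]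

end

end Cache

/-! ### Survival integrals and deterministic estimates for families of cdfs. -/

namespace Cache

/-- The integral of the survival function `1 - g` over `[0, z]`. -/
noncomputable def survivalIntegral (g : ℝ → ℝ) (z : ℝ) : ℝ := ∫ x in (0 : ℝ)..z, (1 - g x)

section survivalIntegral

variable {g : ℝ → ℝ}

theorem intervalIntegrable_survival (hg : Monotone g) (a b : ℝ) :
    IntervalIntegrable (fun x => 1 - g x) volume a b :=
  intervalIntegrable_const.sub hg.intervalIntegrable

@[simp] theorem survivalIntegral_zero : survivalIntegral g 0 = 0 := by simp [survivalIntegral]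

theorem survivalIntegral_sub (hg : Monotone g) (a b : ℝ) :
    survivalIntegral g b - survivalIntegral g a = ∫ x in a..b, (1 - g x) :=
  intervalIntegral.integral_interval_sub_left (intervalIntegrable_survival hg _ _)
    (intervalIntegrable_survival hg _ _)

theorem mul_le_survivalIntegral_sub (hg : Monotone g) {a b : ℝ} (hab : a ≤ b) :
    (b - a) * (1 - g b) ≤ survivalIntegral g b - survivalIntegral g a := by
  rw [survivalIntegral_sub hg, ← smul_eq_mul, ← intervalIntegral.integral_const]
  exact intervalIntegral.integral_mono_on hab intervalIntegrable_const
    (intervalIntegrable_survival hg _ _) fun x hx => by linarith [hg hx.2]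

theorem survivalIntegral_sub_le (hg : Monotone g) {a b : ℝ} (hab : a ≤ b) :
    survivalIntegral g b - survivalIntegral g a ≤ (b - a) * (1 - g a) := by
  rw [survivalIntegral_sub hg, ← smul_eq_mul, ← intervalIntegral.integral_const]
  exact intervalIntegral.integral_mono_on hab
    (intervalIntegrable_survival hg _ _) intervalIntegrable_const fun x hx => by linarith [hg hx.1]

theorem survivalIntegral_mono (hg : Monotone g) (h1 : ∀ x, g x ≤ 1) :
    Monotone (survivalIntegral g) := fun a b hab => by
  have := mul_le_survivalIntegral_sub hg hab
  nlinarith [mul_nonneg (sub_nonneg.2 hab) (sub_nonneg.2 (h1 b))]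

theorem mul_le_survivalIntegral (hg : Monotone g) {z : ℝ} (hz : 0 ≤ z) :
    z * (1 - g z) ≤ survivalIntegral g z := by
  simpa using mul_le_survivalIntegral_sub hg hz

theorem survivalIntegral_le_self (hg : Monotone g) (h0 : ∀ x, 0 ≤ g x) {z : ℝ} (hz : 0 ≤ z) :
    survivalIntegral g z ≤ z := by
  have := survivalIntegral_sub_le hg hz
  simp only [survivalIntegral_zero, sub_zero] at this
  nlinarith [mul_nonneg hz (h0 0)]

theorem continuous_survivalIntegral (hg : Monotone g) : Continuous (survivalIntegral g) :=
  intervalIntegral.continuous_primitive (fun a b => intervalIntegrable_survival hg a b) 0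

theorem survivalIntegral_le_of_le {f : ℝ → ℝ} (hg : Monotone g) (hf : Monotone f)
    (hgf : ∀ x, g x ≤ f x) {z : ℝ} (hz : 0 ≤ z) : survivalIntegral f z ≤ survivalIntegral g z :=
  intervalIntegral.integral_mono_on hz (intervalIntegrable_survival hf _ _)
    (intervalIntegrable_survival hg _ _) fun x _ => by linarith [hgf x]

/-- The survival function is controlled by its tail integral, given a modulus of continuity. -/
theorem mul_survival_le (hg : Monotone g)
    (hs : ∀ z, 0 ≤ z → survivalIntegral g z ≤ 1) {ε h z : ℝ} (hε : 0 < ε) (hh : 0 < h)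
    (hmod : g (z + h) - g z ≤ ε) (hz : 0 ≤ z) :
    z * (1 - g z) ≤ ε * z + 1 / ε / h * (1 - survivalIntegral g z) := by
  have hnn : 0 ≤ 1 - survivalIntegral g z := sub_nonneg.2 (hs z hz)
  -- For moderate `z`, the tail integral over `[z, z + h]` controls `1 - g (z + h)`, and the modulus
  -- transfers this to `z`. For `z > 1 / ε`, the left side is at most 1, already less than `ε z`.
  rcases le_or_gt z (1 / ε) with hzA | hzA
  · have h1 := mul_le_survivalIntegral_sub hg (a := z) (b := z + h) (by linarith)
    have h2 : 1 - g (z + h) ≤ 1 / h * (1 - survivalIntegral g z) := by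
      rw [one_div, ← div_eq_inv_mul, le_div_iff₀ hh]
      have := hs (z + h) (by linarith)
      nlinarith
    have h3 : 1 - g z ≤ ε + 1 / h * (1 - survivalIntegral g z) := by linarith
    calc z * (1 - g z) ≤ z * (ε + 1 / h * (1 - survivalIntegral g z)) :=
          mul_le_mul_of_nonneg_left h3 hz
      _ = ε * z + z * (1 / h * (1 - survivalIntegral g z)) := by ring
      _ ≤ ε * z + 1 / ε * (1 / h * (1 - survivalIntegral g z)) := by gcongr
      _ = _ := by ring
  · have h1 : z * (1 - g z) ≤ 1 := (mul_le_survivalIntegral hg hz).trans (hs z hz)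
    have h2 : 1 ≤ ε * z := by
      rw [div_lt_iff₀ hε] at hzA; linarith
    have h3 : 0 ≤ 1 / ε / h * (1 - survivalIntegral g z) := by positivity
    linarith

theorem one_sub_le_inv (hg : Monotone g) (hs : ∀ z, 0 ≤ z → survivalIntegral g z ≤ 1)
    {z : ℝ} (hz : 0 < z) : 1 - g z ≤ 1 / z := by
  rw [le_div_iff₀ hz, mul_comm]
  exact (mul_le_survivalIntegral hg hz.le).trans (hs z hz.le)

end survivalIntegral

section system

variable {ι : Type*} [Fintype ι] {r : ι → ℝ} {g : ι → ℝ → ℝ}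

theorem sum_survivalIntegral_le (hr : ∀ i, 0 < r i) (hg : ∀ i, Monotone (g i))
    (h0 : ∀ i x, 0 ≤ g i x) {t : ℝ} (ht : 0 ≤ t) :
    ∑ i, survivalIntegral (g i) (r i * t) ≤ (∑ i, r i) * t := by
  rw [Finset.sum_mul]
  exact Finset.sum_le_sum fun i _ =>
    survivalIntegral_le_self (hg i) (h0 i) (mul_nonneg (hr i).le ht)

variable [DecidableEq ι]

/-- Few contents carrying almost all requests are almost always present. -/
theorem sum_mul_survival_le_of_tail (hr : ∀ i, 0 < r i) (hg : ∀ i, Monotone (g i))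
    (h0 : ∀ i x, 0 ≤ g i x) (hs : ∀ i z, 0 ≤ z → survivalIntegral (g i) z ≤ 1)
    (S : Finset ι) {t A : ℝ} (ht : 0 < t) (hA : 0 < A) :
    ∑ i, r i * t * (1 - g i (r i * t))
      ≤ ∑ i ∈ Sᶜ, r i * t + S.card * A + 1 / A * ((∑ i, r i) * t) := by
  rw [← Finset.sum_compl_add_sum S, add_assoc]
  refine add_le_add (Finset.sum_le_sum fun i _ => ?_) ?_
  · have := mul_pos (hr i) ht
    nlinarith [h0 i (r i * t)]
  · have h1 : ∀ i, r i * t * (1 - g i (r i * t)) ≤ A + 1 / A * (r i * t) := by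
      -- Either `r i * t ≤ A`, and the term is at most `A`, or the term is at most 1, hence at most
      -- `r i * t / A`.
      intro i
      have hz := mul_pos (hr i) ht
      rcases le_or_gt (r i * t) A with h | h
      · have : 0 ≤ 1 / A * (r i * t) := by positivity
        nlinarith [h0 i (r i * t)]
      · have h2 : r i * t * (1 - g i (r i * t)) ≤ 1 :=
          (mul_le_survivalIntegral (hg i) hz.le).trans (hs i _ hz.le)
        have h3 : 1 ≤ 1 / A * (r i * t) := by
          rw [one_div, ← div_eq_inv_mul, le_div_iff₀ hA]; linarith
        linarith
    refine (Finset.sum_le_sum fun i _ => h1 i).trans ?_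
    rw [Finset.sum_add_distrib, Finset.sum_const, nsmul_eq_mul, Finset.sum_mul, ← Finset.mul_sum]
    gcongr
    · intro i _ _
      exact (mul_pos (hr i) ht).le
    · exact Finset.subset_univ S

/-- If the contents outside `S` are hardly requested, then those in `S` are almost always
present. -/
theorem sum_mul_survival_le_of_filled (hr : ∀ i, 0 < r i) (hg : ∀ i, Monotone (g i))
    (h0 : ∀ i x, 0 ≤ g i x)
    {ε D : ℝ} (hε : 0 < ε) (hD : 0 < D)
    (hgD : ∀ i z, 0 ≤ z → z * (1 - g i z) ≤ ε * z + D * (1 - survivalIntegral (g i) z))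
    (S : Finset ι) {t c δ η : ℝ} (ht : 0 < t) (hS : (S.card : ℝ) ≤ c)
    (hK : ∑ i, survivalIntegral (g i) (r i * t) = (1 - δ) * c)
    (hη : ∑ i ∈ Sᶜ, r i * t ≤ η * c) :
    ∑ i, r i * t * (1 - g i (r i * t))
      ≤ ε * ((∑ i, r i) * t) + (D * (δ + η) + η) * c := by
  have hz : ∀ i, 0 ≤ r i * t := fun i => (mul_pos (hr i) ht).le
  have h1 : ∑ i ∈ Sᶜ, r i * t * (1 - g i (r i * t)) ≤ η * c := by
    refine (Finset.sum_le_sum fun i _ => ?_).trans hη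
    nlinarith [h0 i (r i * t), hz i]
  have h2 : ∑ i ∈ S, r i * t * (1 - g i (r i * t)) ≤ ε * ((∑ i, r i) * t) + D * ((δ + η) * c) := by
    refine (Finset.sum_le_sum fun i _ => hgD i _ (hz i)).trans ?_
    rw [Finset.sum_add_distrib, ← Finset.mul_sum, ← Finset.mul_sum]
    have h3 : ∑ i ∈ S, r i * t ≤ (∑ i, r i) * t := by
      rw [Finset.sum_mul]
      exact Finset.sum_le_sum_of_subset_of_nonneg (Finset.subset_univ S) fun i _ _ => hz i
    have h4 : ∑ i ∈ S, (1 - survivalIntegral (g i) (r i * t)) ≤ (δ + η) * c := by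
      rw [Finset.sum_sub_distrib, Finset.sum_const, nsmul_eq_mul, mul_one]
      have h5 : ∑ i ∈ Sᶜ, survivalIntegral (g i) (r i * t) ≤ η * c :=
        (Finset.sum_le_sum fun i _ => survivalIntegral_le_self (hg i) (h0 i) (hz i)).trans hη
      have h6 := Finset.sum_compl_add_sum S fun i => survivalIntegral (g i) (r i * t)
      linarith
    gcongr
  rw [← Finset.sum_compl_add_sum S]
  linarith

/-- The contents outside `S` have survival at least `c₀` up to time `(1 + e) t`. They alone make the
expected size change by at least `e c₀ η c > δ c` over a time step `e t`, so a change of `δ c` takes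
less than `e t`. -/
theorem times_close (hr : ∀ i, 0 < r i) (hg : ∀ i, Monotone (g i)) (h1 : ∀ i x, g i x ≤ 1)
    (S : Finset ι) {t₁ t t₂ c δ η e c₀ v : ℝ} (ht : 0 < t) (hc : 0 < c)
    (he : 0 < e) (he1 : e < 1) (hc₀ : 0 < c₀)
    (hv : ∀ i ∈ Sᶜ, r i * t ≤ v) (hgv : ∀ i, c₀ ≤ 1 - g i ((1 + e) * v))
    (hη : η * c ≤ ∑ i ∈ Sᶜ, r i * t)
    (hK₁ : ∑ i, survivalIntegral (g i) (r i * t₁) = (1 - δ) * c)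
    (hK : ∑ i, survivalIntegral (g i) (r i * t) = c)
    (hK₂ : ∑ i, survivalIntegral (g i) (r i * t₂) = (1 + δ) * c)
    (hδ : δ < e * c₀ * η) : (1 - e) * t ≤ t₁ ∧ t₂ ≤ (1 + e) * t := by
  have hz : ∀ i, 0 < r i * t := fun i => mul_pos (hr i) ht
  have hmono : Monotone fun t => ∑ i, survivalIntegral (g i) (r i * t) := fun a b hab =>
    Finset.sum_le_sum fun i _ => survivalIntegral_mono (hg i) (h1 i)
      (mul_le_mul_of_nonneg_left hab (hr i).le)
  have key : ∀ a b, a ≤ b → b - a = e * t → b ≤ (1 + e) * t →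
      e * c₀ * η * c ≤ ∑ i, survivalIntegral (g i) (r i * b)
        - ∑ i, survivalIntegral (g i) (r i * a) := by
    intro a b hab hba hb
    rw [← Finset.sum_sub_distrib]
    calc e * c₀ * η * c = e * c₀ * (η * c) := by ring
      _ ≤ e * c₀ * ∑ i ∈ Sᶜ, r i * t := by gcongr
      _ = ∑ i ∈ Sᶜ, e * c₀ * (r i * t) := by rw [Finset.mul_sum]
      _ ≤ ∑ i ∈ Sᶜ, (survivalIntegral (g i) (r i * b) - survivalIntegral (g i) (r i * a)) := by
          refine Finset.sum_le_sum fun i hi => ?_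
          have hle := mul_le_survivalIntegral_sub (hg i) (mul_le_mul_of_nonneg_left hab (hr i).le)
          have hb' : r i * b ≤ (1 + e) * v :=
            calc r i * b ≤ r i * ((1 + e) * t) := mul_le_mul_of_nonneg_left hb (hr i).le
              _ = (1 + e) * (r i * t) := by ring
              _ ≤ (1 + e) * v := mul_le_mul_of_nonneg_left (hv i hi) (by linarith)
          have hc' : c₀ ≤ 1 - g i (r i * b) := (hgv i).trans (by linarith [hg i hb'])
          calc e * c₀ * (r i * t) = (r i * b - r i * a) * c₀ := by
                rw [← mul_sub, hba]; ring
            _ ≤ (r i * b - r i * a) * (1 - g i (r i * b)) := by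
                refine mul_le_mul_of_nonneg_left hc' ?_
                rw [← mul_sub, hba]
                have := hr i
                positivity
            _ ≤ _ := hle
      _ ≤ _ := Finset.sum_le_sum_of_subset_of_nonneg (Finset.subset_univ _) fun i _ _ =>
          sub_nonneg.2 (survivalIntegral_mono (hg i) (h1 i)
            (mul_le_mul_of_nonneg_left hab (hr i).le))
  have hδc : δ * c < e * c₀ * η * c := mul_lt_mul_of_pos_right hδ hc
  have het : 0 < e * t := mul_pos he ht
  constructor
  · by_contra! h
    have h2 := hmono h.le
    have h3 := key ((1 - e) * t) t (by linarith) (by ring) (by linarith)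
    simp only at h2
    linarith
  · by_contra! h
    have h2 := hmono h.le
    have h3 := key t ((1 + e) * t) (by linarith) (by ring) le_rfl
    simp only at h2
    linarith

/-- For `z ≤ 1 / ε` the two arguments differ by at most `2 e / ε < h`; for larger `z` both values
are within `2 ε` of 1, because survival at `x` is at most `1 / x`. -/
theorem sub_le_of_equicontinuous {f : ℝ → ℝ} (hf : Monotone f) (h1 : ∀ x, f x ≤ 1)
    (hs : ∀ z, 0 ≤ z → survivalIntegral f z ≤ 1) {ε h e z : ℝ} (hε : 0 < ε)
    (he : 0 < e) (he1 : e ≤ 1 / 2) (heh : 2 * e / ε < h)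
    (hmod : ∀ x y, |x - y| < h → |f x - f y| < ε) (hz : 0 < z) :
    f ((1 + e) * z) - f ((1 - e) * z) ≤ 2 * ε := by
  rcases le_or_gt z (1 / ε) with hzA | hzA
  · have hlt : |(1 + e) * z - (1 - e) * z| < h := by
      have h2 : (1 + e) * z - (1 - e) * z = 2 * e * z := by ring
      rw [h2, abs_of_pos (by positivity)]
      refine lt_of_le_of_lt ?_ heh
      calc 2 * e * z ≤ 2 * e * (1 / ε) := by gcongr
        _ = 2 * e / ε := by ring
    have := (abs_lt.1 (hmod _ _ hlt)).2
    linarith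
  · have hz2 : 0 < (1 - e) * z := mul_pos (by linarith) hz
    have h2 := one_sub_le_inv hf hs hz2
    have h3 : 1 / ((1 - e) * z) ≤ 2 * ε := by
      rw [div_le_iff₀ hz2]
      rw [div_lt_iff₀ hε] at hzA
      nlinarith
    linarith [h1 ((1 + e) * z)]

end system

section cdf

variable (Ψ : Measure ℝ) [IsProbabilityMeasure Ψ]

/-- By the layer-cake formula the survival integral over the half-line is the mean. -/
theorem exists_le_survivalIntegral_cdf (hsupp : Ψ (Iio 0) = 0) (hmean : 0 < ∫ x, x ∂Ψ) {b : ℝ}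
    (hb : b < ∫ x, x ∂Ψ) : ∃ X, 0 ≤ X ∧ b ≤ survivalIntegral (cdf Ψ) X := by
  -- A non-integrable function has Bochner integral 0, so a positive mean forces integrability.
  have hint : Integrable (fun x : ℝ => x) Ψ := by
    by_contra h
    rw [integral_undef h] at hmean
    exact lt_irrefl _ hmean
  have hnn : 0 ≤ᵐ[Ψ] fun x : ℝ => x := by
    rw [EventuallyLE, ae_iff]
    simpa [Set.Iio] using hsupp
  have hlc := lintegral_eq_lintegral_meas_lt Ψ hnn hint.aemeasurable
  have hsurv : ∀ t : ℝ, Ψ {a | t < a} = ENNReal.ofReal (1 - cdf Ψ t) := by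
    intro t
    rw [cdf_eq_real, ← probReal_compl_eq_one_sub measurableSet_Iic, ofReal_measureReal, compl_Iic]
    rfl
  simp_rw [hsurv] at hlc
  have hmono : Monotone (cdf Ψ) := monotone_cdf Ψ
  have hfin : ∫⁻ t in Ioi (0 : ℝ), ENNReal.ofReal (1 - cdf Ψ t) ≠ ∞ := by
    rw [← hlc]
    exact (hint.lintegral_lt_top).ne
  have hsnn : ∀ t, 0 ≤ 1 - cdf Ψ t := fun t => sub_nonneg.2 (cdf_le_one Ψ t)
  have hion : IntegrableOn (fun t => 1 - cdf Ψ t) (Ioi 0) := by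
    refine ⟨(measurable_const.sub hmono.measurable).aestronglyMeasurable, ?_⟩
    rw [hasFiniteIntegral_iff_ofReal (Eventually.of_forall hsnn)]
    exact hfin.lt_top
  have heq : ∫ x, x ∂Ψ = ∫ t in Ioi (0 : ℝ), (1 - cdf Ψ t) := by
    rw [integral_eq_lintegral_of_nonneg_ae hnn hint.aestronglyMeasurable, hlc,
      integral_eq_lintegral_of_nonneg_ae (Eventually.of_forall hsnn) hion.aestronglyMeasurable]
  have htend := intervalIntegral_tendsto_integral_Ioi 0 hion tendsto_id
  rw [← heq] at htend
  obtain ⟨X, hX, hX0⟩ := ((htend.eventually (lt_mem_nhds hb)).and (eventually_ge_atTop 0)).exists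
  exact ⟨X, hX0, hX.le⟩

theorem exists_survivalIntegral_cdf_eq (hsupp : Ψ (Iio 0) = 0) (hmean : 0 < ∫ x, x ∂Ψ) {b : ℝ}
    (hb0 : 0 < b) (hb : b < ∫ x, x ∂Ψ) :
    ∃ v, 0 < v ∧ survivalIntegral (cdf Ψ) v = b ∧ cdf Ψ v < 1 := by
  have hmono : Monotone (cdf Ψ) := monotone_cdf Ψ
  obtain ⟨X, hX0, hX⟩ := exists_le_survivalIntegral_cdf Ψ hsupp hmean hb
  obtain ⟨v, hv, hvb⟩ := intermediate_value_Icc hX0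
    (continuous_survivalIntegral hmono).continuousOn
    (show b ∈ Icc (survivalIntegral (cdf Ψ) 0) (survivalIntegral (cdf Ψ) X) from
      ⟨by simpa using hb0.le, hX⟩)
  refine ⟨v, ?_, hvb, ?_⟩
  · refine lt_of_le_of_ne hv.1 ?_
    rintro rfl
    simp at hvb
    exact hb0.ne hvb
  -- If the cdf reached 1 at `v`, the survival integral would stop growing at `b`, yet it exceeds
  -- some `b' > b`.
  · by_contra! h1
    obtain ⟨b', hb', hb'm⟩ := exists_between hb
    obtain ⟨Y, hY0, hY⟩ := exists_le_survivalIntegral_cdf Ψ hsupp hmean hb'm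
    have hm := survivalIntegral_mono hmono (cdf_le_one Ψ)
    rcases le_total Y v with h | h
    · have := hm h
      linarith
    · have h2 := survivalIntegral_sub_le hmono h
      nlinarith [mul_nonneg (sub_nonneg.2 h) (sub_nonneg.2 h1)]

end cdf

end Cache

/-! ### Popularity ranks and estimates for a single regular system. -/

namespace Cache

open PointConfig

/-- The `k` most popular contents. -/
noncomputable def topSet {n : ℕ} (μ : Measure (Fin n → PointConfig)) (k : ℕ) : Finset (Fin n) :=
  (Finset.univ.filter fun j : Fin n => j.val < k).map
    (Tuple.sort fun i => -popularity μ i).toEmbedding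

section topSet

variable {n : ℕ} (μ : Measure (Fin n → PointConfig))

theorem mem_topSet {k : ℕ} {j : Fin n} :
    Tuple.sort (fun i => -popularity μ i) j ∈ topSet μ k ↔ j.val < k := by
  simp [topSet]

theorem card_topSet_le (k : ℕ) : (topSet μ k).card ≤ k := by
  rw [topSet, Finset.card_map]
  have h := Finset.card_le_card_of_injOn (s := Finset.univ.filter fun j : Fin n => j.val < k)
    (t := Finset.range k) (fun j => j.val) (by intro j hj; simpa using hj)
    (fun a _ b _ hab => Fin.ext hab)
  simpa using h

theorem card_topSet_of_notMem {k : ℕ} {i : Fin n} (hi : i ∉ topSet μ k) :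
    (topSet μ k).card = k := by
  obtain ⟨j, rfl⟩ := (Tuple.sort fun i => -popularity μ i).surjective i
  rw [mem_topSet, not_lt] at hi
  rw [topSet, Finset.card_map]
  have hk : k < n := hi.trans_lt j.2
  have : (Finset.univ.filter fun j : Fin n => j.val < k) = Finset.Iio ⟨k, hk⟩ := by
    ext l; simp [Fin.lt_def]
  rw [this, Fin.card_Iio]

theorem popularity_le_of_mem_topSet {k : ℕ} {i j : Fin n} (hi : i ∉ topSet μ k)
    (hj : j ∈ topSet μ k) : popularity μ i ≤ popularity μ j := by
  obtain ⟨i, rfl⟩ := (Tuple.sort fun i => -popularity μ i).surjective i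
  obtain ⟨j, rfl⟩ := (Tuple.sort fun i => -popularity μ i).surjective j
  rw [mem_topSet] at hi hj
  have h := Tuple.monotone_sort (fun i => -popularity μ i)
    (show j ≤ i from Fin.le_def.2 (by omega))
  simpa using h

theorem tailPopularity_eq (k : ℕ) :
    tailPopularity μ k = ∑ i ∈ (topSet μ k)ᶜ, popularity μ i := by
  have : (topSet μ k)ᶜ = (Finset.univ.filter fun j : Fin n => k ≤ j.val).map
      (Tuple.sort fun i => -popularity μ i).toEmbedding := by
    ext i
    obtain ⟨i, rfl⟩ := (Tuple.sort fun i => -popularity μ i).surjective i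
    rw [Finset.mem_compl, mem_topSet]
    simp
  rw [this, Finset.sum_map]
  rfl

theorem tailPopularity_antitone : Antitone (tailPopularity μ) := by
  intro k l hkl
  refine Finset.sum_le_sum_of_subset_of_nonneg ?_ fun _ _ _ => popularity_nonneg _ _
  intro j hj
  rw [Finset.mem_filter] at hj ⊢
  exact ⟨hj.1, hkl.trans hj.2⟩

theorem tailPopularity_le_one (k : ℕ) : tailPopularity μ k ≤ 1 := by
  rw [tailPopularity_eq]
  refine (Finset.sum_le_sum_of_subset_of_nonneg (Finset.subset_univ _)
    fun _ _ _ => popularity_nonneg _ _).trans ?_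
  simp_rw [popularity]
  rw [← Finset.sum_div]
  exact div_self_le_one _

end topSet

/-- The properties of a cache system used in the asymptotic analysis. -/
structure IsRegular {n : ℕ} (μ : Measure (Fin n → PointConfig)) (ψ : ℝ → ℝ) : Prop where
  rate_pos : ∀ i, 0 < rate μ i
  sum_rate_pos : 0 < ∑ i, rate μ i
  mono : ∀ i, Monotone (scaledCdf μ i)
  nonneg : ∀ i x, 0 ≤ scaledCdf μ i x
  le_one : ∀ i x, scaledCdf μ i x ≤ 1
  survivalIntegral_le_one : ∀ i z, 0 ≤ z → survivalIntegral (scaledCdf μ i) z ≤ 1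
  le_bound : ∀ i x, scaledCdf μ i x ≤ ψ x
  expectedSize_eq : ∀ t, 0 ≤ t →
    expectedSize μ t = ∑ i, survivalIntegral (scaledCdf μ i) (rate μ i * t)

namespace IsRegular

variable {n : ℕ} {μ : Measure (Fin n → PointConfig)} {ψ : ℝ → ℝ}

theorem meanCdf_eq (hμ : IsRegular μ ψ) (t : ℝ) :
    meanCdf μ t = ∑ i, popularity μ i * scaledCdf μ i (rate μ i * t) :=
  Finset.sum_congr rfl fun i _ => by
    rw [scaledCdf, mul_div_cancel_left₀ _ (hμ.rate_pos i).ne']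

theorem monotone_meanCdf (hμ : IsRegular μ ψ) : Monotone (meanCdf μ) := fun s t hst => by
  rw [hμ.meanCdf_eq, hμ.meanCdf_eq]
  exact Finset.sum_le_sum fun i _ => mul_le_mul_of_nonneg_left
    (hμ.mono i (mul_le_mul_of_nonneg_left hst (hμ.rate_pos i).le)) (popularity_nonneg _ _)

theorem meanCdf_le_one (hμ : IsRegular μ ψ) (t : ℝ) : meanCdf μ t ≤ 1 := by
  rw [hμ.meanCdf_eq, ← sum_popularity hμ.sum_rate_pos]
  exact Finset.sum_le_sum fun i _ =>
    mul_le_of_le_one_right (popularity_nonneg _ _) (hμ.le_one _ _)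

theorem one_sub_meanCdf_mul (hμ : IsRegular μ ψ) (t : ℝ) :
    (1 - meanCdf μ t) * ((∑ i, rate μ i) * t)
      = ∑ i, rate μ i * t * (1 - scaledCdf μ i (rate μ i * t)) := by
  have hΛ := hμ.sum_rate_pos
  have h1 : 1 - meanCdf μ t = ∑ i, popularity μ i * (1 - scaledCdf μ i (rate μ i * t)) := by
    simp_rw [mul_sub, mul_one]
    rw [Finset.sum_sub_distrib, sum_popularity hΛ, hμ.meanCdf_eq]
  rw [h1, Finset.sum_mul]
  refine Finset.sum_congr rfl fun i _ => ?_
  rw [popularity]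
  field_simp

theorem sum_compl_topSet (hμ : IsRegular μ ψ) (k : ℕ) (t : ℝ) :
    ∑ i ∈ (topSet μ k)ᶜ, rate μ i * t = tailPopularity μ k * ((∑ i, rate μ i) * t) := by
  have hΛ := hμ.sum_rate_pos
  rw [tailPopularity_eq, Finset.sum_mul]
  refine Finset.sum_congr rfl fun i _ => ?_
  rw [popularity]
  field_simp

theorem expectedSize_le (hμ : IsRegular μ ψ) {t : ℝ} (ht : 0 ≤ t) :
    expectedSize μ t ≤ (∑ i, rate μ i) * t := by
  rw [hμ.expectedSize_eq t ht]
  exact sum_survivalIntegral_le hμ.rate_pos hμ.mono hμ.nonneg ht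

/-- The contents beyond the `κ C` most popular ones are requested at a bounded normalized rate. -/
theorem rate_mul_le (hμ : IsRegular μ ψ) (hψ : Monotone ψ) {κ v c t : ℝ}
    (hκ : 0 < κ) (hv0 : 0 < v) (hv : survivalIntegral ψ v = 1 / κ)
    (ht : 0 < t) (hK : expectedSize μ t = c) {i : Fin n} (hi : i ∈ (topSet μ ⌈κ * c⌉₊)ᶜ) :
    rate μ i * t ≤ v := by
  rw [Finset.mem_compl] at hi
  by_contra! hlt
  -- If `i` exceeds `v`, so do all contents ranked above it. Each is then present with probability
  -- at least `1 / κ`, and these `⌈κ c⌉ + 1` contents would make the expected size exceed `c`.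
  have hle : ∀ j ∈ insert i (topSet μ ⌈κ * c⌉₊),
      1 / κ ≤ survivalIntegral (scaledCdf μ j) (rate μ j * t) := by
    intro j hj
    have hij : rate μ i ≤ rate μ j := by
      rcases Finset.mem_insert.1 hj with rfl | hj
      · exact le_rfl
      · have := popularity_le_of_mem_topSet μ hi hj
        rwa [popularity, popularity, div_le_div_iff_of_pos_right hμ.sum_rate_pos] at this
    have hvj : v ≤ rate μ j * t := hlt.le.trans (mul_le_mul_of_nonneg_right hij ht.le)
    rw [← hv]
    exact (survivalIntegral_le_of_le (hμ.mono j) hψ (hμ.le_bound j) hv0.le).trans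
      (survivalIntegral_mono (hμ.mono j) (hμ.le_one j) hvj)
  have hsum := Finset.card_nsmul_le_sum _ _ _ hle
  rw [Finset.card_insert_of_notMem hi, card_topSet_of_notMem μ hi, nsmul_eq_mul] at hsum
  have htot : ∑ j ∈ insert i (topSet μ ⌈κ * c⌉₊),
      survivalIntegral (scaledCdf μ j) (rate μ j * t) ≤ c := by
    rw [← hK, hμ.expectedSize_eq t ht.le]
    refine Finset.sum_le_sum_of_subset_of_nonneg (Finset.subset_univ _) fun j _ _ => ?_
    rw [← survivalIntegral_zero (g := scaledCdf μ j)]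
    exact survivalIntegral_mono (hμ.mono j) (hμ.le_one j) (mul_pos (hμ.rate_pos j) ht).le
  have h1 := hsum.trans htot
  rw [mul_one_div, div_le_iff₀ hκ] at h1
  have h2 := Nat.le_ceil (κ * c)
  push_cast at h1
  linarith

/-- A bound for the miss probability when few contents carry almost all requests. -/
theorem one_sub_meanCdf_le_of_tail (hμ : IsRegular μ ψ) {ε c δ t : ℝ} {m : ℕ} (hε : 0 < ε)
    (ht : 0 < t) (hδ : δ ≤ 1 / 2) (hc : 0 < c) (hK : expectedSize μ t = (1 - δ) * c)
    (hm : tailPopularity μ m ≤ ε) (hmc : 2 * m / ε ≤ ε * c) : 1 - meanCdf μ t ≤ 3 * ε := by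
  have hpos : 0 < (∑ i, rate μ i) * t := mul_pos hμ.sum_rate_pos ht
  have hle := hμ.expectedSize_le ht.le
  rw [hK] at hle
  rw [← mul_le_mul_iff_left₀ hpos, hμ.one_sub_meanCdf_mul]
  refine (sum_mul_survival_le_of_tail hμ.rate_pos hμ.mono hμ.nonneg hμ.survivalIntegral_le_one
    (topSet μ m) ht (one_div_pos.2 hε)).trans ?_
  rw [hμ.sum_compl_topSet, one_div_one_div]
  have h1 : tailPopularity μ m * ((∑ i, rate μ i) * t) ≤ ε * ((∑ i, rate μ i) * t) := by gcongr
  -- The boundedly many top contents cost at most `m / ε`, negligible against `Λ t ≥ K(t) ≥ c / 2`.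
  have h2 : ((topSet μ m).card : ℝ) * (1 / ε) ≤ ε * ((∑ i, rate μ i) * t) := by
    have h3 : ((topSet μ m).card : ℝ) ≤ m := by exact_mod_cast card_topSet_le μ m
    calc ((topSet μ m).card : ℝ) * (1 / ε) ≤ m * (1 / ε) := by gcongr
      _ = (2 * m / ε) / 2 := by ring
      _ ≤ ε * c / 2 := by gcongr
      _ = ε * ((1 - 1 / 2) * c) := by ring
      _ ≤ ε * ((1 - δ) * c) := by gcongr
      _ ≤ _ := by gcongr
  linarith

/-- The increment of the mean inter-request cdf when the inter-request cdfs are equicontinuous. -/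
theorem meanCdf_sub_le (hμ : IsRegular μ ψ) (hψ : Monotone ψ)
    {κ γ ε h e v c δ η t₁ t t₂ : ℝ} (hε : 0 < ε) (hh : 0 < h)
    (hmod : ∀ i x y, |x - y| < h → |scaledCdf μ i x - scaledCdf μ i y| < ε)
    (he : 0 < e) (he1 : e ≤ 1 / 2) (heh : 2 * e / ε < h)
    (hκ : 0 < κ) (hv0 : 0 < v) (hv : survivalIntegral ψ v = 1 / κ) (hψv : ψ ((1 + e) * v) < 1)
    (hγ : 0 < γ) (hη : 0 < η)
    (hP : γ * tailPopularity μ ⌊c⌋₊ ≤ tailPopularity μ ⌈κ * c⌉₊)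
    (hc : 0 < c) (hδ0 : 0 < δ) (hδ1 : δ ≤ 1 / 2) (hδ : δ < e * (1 - ψ ((1 + e) * v)) * (γ * η))
    (ht₁ : 0 < t₁) (h1 : t₁ ≤ t) (h2 : t ≤ t₂)
    (hK₁ : expectedSize μ t₁ = (1 - δ) * c) (hK : expectedSize μ t = c)
    (hK₂ : expectedSize μ t₂ = (1 + δ) * c) :
    meanCdf μ t₂ - meanCdf μ t₁ ≤ 2 * ε + 2 * (1 / ε / (h / 2) * (δ + η) + η) := by
  have ht : 0 < t := ht₁.trans_le h1
  have ht₂ : 0 < t₂ := ht.trans_le h2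
  have hΛt : 0 < (∑ i, rate μ i) * t := mul_pos hμ.sum_rate_pos ht
  have hK₁' := hK₁
  have hK' := hK
  rw [hμ.expectedSize_eq t₁ ht₁.le] at hK₁
  rw [hμ.expectedSize_eq t ht.le] at hK
  rw [hμ.expectedSize_eq t₂ ht₂.le] at hK₂
  -- Either the contents beyond rank `κ c` have enough total rate to pin down `t₁` and `t₂`, or `hP`
  -- makes the total rate beyond rank `c` negligible and forces the miss probability at `t₁` to be
  -- small.
  rcases le_or_gt (γ * η * c) (∑ i ∈ (topSet μ ⌈κ * c⌉₊)ᶜ, rate μ i * t) with hcase | hcase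
  · obtain ⟨hc1, hc2⟩ := times_close hμ.rate_pos hμ.mono hμ.le_one (topSet μ ⌈κ * c⌉₊) ht hc he
      (by linarith) (sub_pos.2 hψv) (fun i hi => hμ.rate_mul_le hψ hκ hv0 hv ht hK' hi)
      (fun i => by linarith [hμ.le_bound i ((1 + e) * v)]) hcase hK₁ hK hK₂ hδ
    have hinc : meanCdf μ ((1 + e) * t) - meanCdf μ ((1 - e) * t) ≤ 2 * ε := by
      have hsum : ∑ i, popularity μ i * (2 * ε) = 2 * ε := by
        rw [← Finset.sum_mul, sum_popularity hμ.sum_rate_pos, one_mul]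
      rw [hμ.meanCdf_eq, hμ.meanCdf_eq, ← Finset.sum_sub_distrib]
      refine (Finset.sum_le_sum fun i _ => ?_).trans hsum.le
      have := sub_le_of_equicontinuous (hμ.mono i) (hμ.le_one i) (hμ.survivalIntegral_le_one i)
        hε he he1 heh (hmod i) (mul_pos (hμ.rate_pos i) ht)
      rw [mul_left_comm (1 + e), mul_left_comm (1 - e)] at this
      rw [← mul_sub]
      exact mul_le_mul_of_nonneg_left this (popularity_nonneg _ _)
    have h3 := hμ.monotone_meanCdf hc1
    have h4 := hμ.monotone_meanCdf hc2
    have h5 : 0 ≤ 2 * (1 / ε / (h / 2) * (δ + η) + η) := by positivity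
    linarith
  · set D := 1 / ε / (h / 2) with hD
    have hDpos : 0 < D := by positivity
    have hpos : 0 < (∑ i, rate μ i) * t₁ := mul_pos hμ.sum_rate_pos ht₁
    have hηc : ∑ i ∈ (topSet μ ⌊c⌋₊)ᶜ, rate μ i * t₁ ≤ η * c := by
      refine (Finset.sum_le_sum fun i _ => mul_le_mul_of_nonneg_left h1 (hμ.rate_pos i).le).trans ?_
      rw [hμ.sum_compl_topSet] at hcase ⊢
      have h3 := mul_le_mul_of_nonneg_right hP hΛt.le
      have h4 : γ * (tailPopularity μ ⌊c⌋₊ * ((∑ i, rate μ i) * t)) ≤ γ * (η * c) := by linarith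
      exact le_of_mul_le_mul_left h4 hγ
    have hcard : ((topSet μ ⌊c⌋₊).card : ℝ) ≤ c :=
      (Nat.cast_le.2 (card_topSet_le μ _)).trans (Nat.floor_le hc.le)
    have hmiss := sum_mul_survival_le_of_filled hμ.rate_pos hμ.mono hμ.nonneg hε hDpos
      (fun i z hz => mul_survival_le (hμ.mono i) (hμ.survivalIntegral_le_one i) hε (half_pos hh)
        (by
          have := hmod i (z + h / 2) z (by rw [add_sub_cancel_left, abs_of_pos] <;> linarith)
          exact ((le_abs_self _).trans_lt this).le) hz)
      (topSet μ ⌊c⌋₊) ht₁ hcard hK₁ hηc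
    rw [← hμ.one_sub_meanCdf_mul] at hmiss
    have hle := hμ.expectedSize_le ht₁.le
    rw [hK₁'] at hle
    have hB : 0 ≤ D * (δ + η) + η := by positivity
    have h5 : (D * (δ + η) + η) * c
        ≤ 2 * (D * (δ + η) + η) * ((∑ i, rate μ i) * t₁) := by
      have h6 : c ≤ 2 * ((∑ i, rate μ i) * t₁) := by nlinarith
      calc (D * (δ + η) + η) * c ≤ (D * (δ + η) + η) * (2 * ((∑ i, rate μ i) * t₁)) := by gcongr
        _ = _ := by ring
    have h7 : 1 - meanCdf μ t₁ ≤ ε + 2 * (D * (δ + η) + η) := by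
      rw [← mul_le_mul_iff_left₀ hpos]
      linarith
    linarith [hμ.meanCdf_le_one t₂]

/-- The expected size is continuous and vanishes at time 0, so intermediate values give both times
once it is known to reach `(1 + δ) c`. -/
theorem exists_times (hμ : IsRegular μ ψ) (hψ : Monotone ψ) {β δ c t X : ℝ}
    (hX : 0 ≤ X) (hβ : (1 + δ) * β ≤ survivalIntegral ψ X) (hc : 0 < c) (hcn : c ≤ β * n)
    (hδ0 : 0 < δ) (hδ1 : δ < 1) (ht : 0 ≤ t) (hK : expectedSize μ t = c) :
    ∃ t₁ t₂, 0 < t₁ ∧ t₁ ≤ t ∧ t ≤ t₂ ∧ expectedSize μ t₁ = (1 - δ) * c ∧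
      expectedSize μ t₂ = (1 + δ) * c := by
  set K : ℝ → ℝ := fun t => ∑ i, survivalIntegral (scaledCdf μ i) (rate μ i * t) with hKdef
  have hcont : Continuous K := continuous_finsetSum _ fun i _ =>
    (continuous_survivalIntegral (hμ.mono i)).comp (continuous_const.mul continuous_id)
  have hK0 : K 0 = 0 := by simp [hKdef]
  have hKt : K t = c := by rw [← hK, hμ.expectedSize_eq t ht]
  obtain ⟨s, hs0, hs⟩ : ∃ s, 0 ≤ s ∧ (1 + δ) * c ≤ K s := by
    -- A time so long that every content has normalized age at least `X`; the expected size is then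
    -- at least `n` times the survival integral of `ψ` up to `X`.
    refine ⟨∑ i, X / rate μ i, Finset.sum_nonneg fun i _ => div_nonneg hX (hμ.rate_pos i).le, ?_⟩
    have hi : ∀ i ∈ (Finset.univ : Finset (Fin n)), survivalIntegral ψ X
        ≤ survivalIntegral (scaledCdf μ i) (rate μ i * ∑ i, X / rate μ i) := by
      intro i _
      refine (survivalIntegral_le_of_le (hμ.mono i) hψ (hμ.le_bound i) hX).trans
        (survivalIntegral_mono (hμ.mono i) (hμ.le_one i) ?_)
      have h1 : X / rate μ i ≤ ∑ i, X / rate μ i := Finset.single_le_sum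
        (f := fun i => X / rate μ i) (fun j _ => div_nonneg hX (hμ.rate_pos j).le)
        (Finset.mem_univ i)
      rw [div_le_iff₀ (hμ.rate_pos i)] at h1
      linarith
    have h2 := Finset.card_nsmul_le_sum _ _ _ hi
    rw [Finset.card_univ, Fintype.card_fin, nsmul_eq_mul] at h2
    calc (1 + δ) * c ≤ (1 + δ) * (β * n) := by gcongr
      _ = n * ((1 + δ) * β) := by ring
      _ ≤ n * survivalIntegral ψ X := by gcongr
      _ ≤ _ := h2
  have hδc : 0 < δ * c := mul_pos hδ0 hc
  obtain ⟨t₁, ht₁, hKt₁⟩ := intermediate_value_Icc ht hcont.continuousOn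
    (show (1 - δ) * c ∈ Icc (K 0) (K t) from
      ⟨by rw [hK0]; exact mul_nonneg (by linarith) hc.le, by rw [hKt]; linarith⟩)
  have hts : t ≤ s := by
    by_contra! hlt
    have hmono : K s ≤ K t := Finset.sum_le_sum fun i _ =>
      survivalIntegral_mono (hμ.mono i) (hμ.le_one i)
        (mul_le_mul_of_nonneg_left hlt.le (hμ.rate_pos i).le)
    linarith
  obtain ⟨t₂, ht₂, hKt₂⟩ := intermediate_value_Icc hts hcont.continuousOn
    (show (1 + δ) * c ∈ Icc (K t) (K s) from ⟨by rw [hKt]; linarith, hs⟩)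
  refine ⟨t₁, t₂, lt_of_le_of_ne ht₁.1 ?_, ht₁.2, ht₂.1, ?_, ?_⟩
  · rintro rfl
    rw [hK0] at hKt₁
    have : 0 < (1 - δ) * c := mul_pos (by linarith) hc
    linarith
  · rw [hμ.expectedSize_eq _ ht₁.1, ← hKt₁]
  · rw [hμ.expectedSize_eq _ (ht.trans ht₂.1), ← hKt₂]

end IsRegular

end Cache

/-! ### Uniform asymptotics and the conclusion. -/

namespace Cache

open PointConfig

theorem isRegular_pi {n : ℕ} {ν : Fin n → Measure PointConfig} [∀ i, IsProbabilityMeasure (ν i)]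
    (hν : ∀ i, IsStationary (ν i)) (hfin : ∀ i, PointConfig.palmMeasure (ν i) univ ≠ ∞)
    (hpos : ∀ i, 0 < rate (Measure.pi ν) i) (hn : 0 < n) {ψ : ℝ → ℝ}
    (hψ : ∀ i x, scaledCdf (Measure.pi ν) i x ≤ ψ x) : IsRegular (Measure.pi ν) ψ where
  rate_pos := hpos
  sum_rate_pos := Finset.sum_pos (fun i _ => hpos i) ⟨⟨0, hn⟩, Finset.mem_univ _⟩
  mono i := fun _ _ hst => interCdf_mono hfin i (div_le_div_of_nonneg_right hst (hpos i).le)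
  nonneg _ _ := interCdf_nonneg _ _ _
  le_one _ _ := interCdf_le_one hfin _ _
  survivalIntegral_le_one i z hz := by
    have h := requestProb_eq_integral hfin hν (hpos i) (div_nonneg hz (hpos i).le)
    rw [mul_div_cancel₀ _ (hpos i).ne'] at h
    rw [survivalIntegral, ← h]
    exact measureReal_le_one
  le_bound := hψ
  expectedSize_eq t ht := by
    rw [expectedSize_eq]
    exact Finset.sum_congr rfl fun i _ => requestProb_eq_integral hfin hν (hpos i) ht

section asymptotics

variable {μ : (n : ℕ) → Measure (Fin n → PointConfig)} {C T : ℕ → ℝ}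

/-- Fixes the constants of `IsRegular.meanCdf_sub_le` independently of `n`, in the order `v`, `h`,
`e`, `η`, `δ`. -/
theorem eventually_meanCdf_sub_le_of_equicontinuous {Ψ : Measure ℝ} [IsProbabilityMeasure Ψ]
    (hμ : ∀ n, 0 < n → IsRegular (μ n) (cdf Ψ))
    (hΨ_cont : Continuous (cdf Ψ)) (hΨ_supp : Ψ (Iio 0) = 0) (hΨ_mean : 0 < ∫ x, x ∂Ψ)
    (hC : ∀ᶠ n in atTop, 0 < C n) (hT : ∀ᶠ n in atTop, expectedSize (μ n) (T n) = C n)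
    {κ₁ κ₂ γ : ℝ} (hκ₁ : 1 / ∫ x, x ∂Ψ < κ₁) (hκ₂ : κ₂ ≤ 1) (hγ : 0 < γ)
    (hP : ∀ᶠ n in atTop, γ * tailPopularity (μ n) ⌊κ₂ * C n⌋₊
      < tailPopularity (μ n) ⌈κ₁ * C n⌉₊)
    (hmod : ∀ ε > 0, ∃ h > 0, ∀ n i x y, |x - y| < h →
      |scaledCdf (μ n) i x - scaledCdf (μ n) i y| < ε)
    {ε δ₀ : ℝ} (hε : 0 < ε) (hδ₀ : 0 < δ₀) :
    ∃ δ, 0 < δ ∧ δ ≤ δ₀ ∧ δ ≤ 1 / 2 ∧ ∀ᶠ n in atTop, ∀ t₁ t₂, 0 < t₁ → t₁ ≤ T n → T n ≤ t₂ →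
      expectedSize (μ n) t₁ = (1 - δ) * C n → expectedSize (μ n) t₂ = (1 + δ) * C n →
      meanCdf (μ n) t₂ - meanCdf (μ n) t₁ ≤ 8 * ε := by
  have hκ0 : 0 < κ₁ := (one_div_pos.2 hΨ_mean).trans hκ₁
  obtain ⟨v, hv0, hv, hv1⟩ := exists_survivalIntegral_cdf_eq Ψ hΨ_supp hΨ_mean
    (one_div_pos.2 hκ0) ((one_div_lt hΨ_mean hκ0).1 hκ₁)
  obtain ⟨h, hh, hmod⟩ := hmod ε hε
  have hev : ∀ᶠ e : ℝ in 𝓝[>] 0, cdf Ψ ((1 + e) * v) < 1 := by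
    have hcont : Continuous fun e : ℝ => cdf Ψ ((1 + e) * v) := by fun_prop
    have := hcont.tendsto 0
    simp only [add_zero, one_mul] at this
    exact (this.mono_left nhdsWithin_le_nhds).eventually (gt_mem_nhds hv1)
  obtain ⟨e, ⟨hψv, he1, heh⟩, he⟩ := ((hev.and ((eventually_nhdsWithin_of_eventually_nhds
    (eventually_le_nhds (show (0 : ℝ) < 1 / 2 by norm_num))).and
    (eventually_nhdsWithin_of_eventually_nhds (eventually_lt_nhds
      (show (0 : ℝ) < h * ε / 2 by positivity))))).and self_mem_nhdsWithin).exists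
  have heh' : 2 * e / ε < h := by
    rw [div_lt_iff₀ hε]; linarith
  set D := 1 / ε / (h / 2) with hD
  have hDpos : 0 < D := by positivity
  -- Chosen so that `D η + η = ε`. With `δ ≤ η` the filled-cache case costs at most `2 ε + 4 ε`,
  -- while `δ < q` is what the growth case requires.
  set η := ε / (D + 1) with hηdef
  have hη : 0 < η := by positivity
  have hDη : D * η + η = ε := by rw [hηdef]; field_simp
  have hq : 0 < e * (1 - cdf Ψ ((1 + e) * v)) * (γ * η) :=
    mul_pos (mul_pos he (sub_pos.2 hψv)) (mul_pos hγ hη)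
  set q := e * (1 - cdf Ψ ((1 + e) * v)) * (γ * η) with hqdef
  refine ⟨min (min δ₀ (1 / 2)) (min η (q / 2)), by positivity,
    (min_le_left _ _).trans (min_le_left _ _), (min_le_left _ _).trans (min_le_right _ _), ?_⟩
  set δ := min (min δ₀ (1 / 2)) (min η (q / 2)) with hδdef
  have hδpos : 0 < δ := by positivity
  have hδ1 : δ ≤ 1 / 2 := (min_le_left _ _).trans (min_le_right _ _)
  have hδη : δ ≤ η := (min_le_right _ _).trans (min_le_left _ _)
  have hδq : δ < q := ((min_le_right _ _).trans (min_le_right _ _)).trans_lt (half_lt_self hq)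
  filter_upwards [hC, hT, hP, eventually_gt_atTop 0] with n hCn hTn hPn hn t₁ t₂ ht₁ h1 h2 hK₁ hK₂
  -- Since `κ₂ ≤ 1`, the tail beyond `C` is no larger than the one beyond `κ₂ C`.
  have hPn' : γ * tailPopularity (μ n) ⌊C n⌋₊ ≤ tailPopularity (μ n) ⌈κ₁ * C n⌉₊ := by
    refine le_trans (mul_le_mul_of_nonneg_left (tailPopularity_antitone (μ n) (Nat.floor_mono ?_))
      hγ.le) hPn.le
    nlinarith
  have hres := (hμ n hn).meanCdf_sub_le (monotone_cdf Ψ) hε hh (hmod n) he he1 heh' hκ0 hv0 hv hψv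
    hγ hη hPn' hCn hδpos hδ1 hδq ht₁ h1 h2 hK₁ hTn hK₂
  rw [← hD] at hres
  have h3 : D * (δ + η) + η ≤ 2 * ε := by nlinarith
  linarith

theorem eventually_meanCdf_sub_le_of_tail {ψ : ℝ → ℝ}
    (hμ : ∀ n, 0 < n → IsRegular (μ n) ψ) (hC_top : Tendsto C atTop atTop)
    (htail : Tendsto (fun m : ℕ => limsup (fun n => tailPopularity (μ n) m) atTop) atTop (𝓝 0))
    {ε δ₀ : ℝ} (hε : 0 < ε) (hδ₀ : 0 < δ₀) :
    ∃ δ, 0 < δ ∧ δ ≤ δ₀ ∧ δ ≤ 1 / 2 ∧ ∀ᶠ n in atTop, ∀ t₁ t₂, 0 < t₁ → t₁ ≤ T n → T n ≤ t₂ →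
      expectedSize (μ n) t₁ = (1 - δ) * C n → expectedSize (μ n) t₂ = (1 + δ) * C n →
      meanCdf (μ n) t₂ - meanCdf (μ n) t₁ ≤ 8 * ε := by
  obtain ⟨m, hm⟩ := (htail.eventually (gt_mem_nhds hε)).exists
  have hev : ∀ᶠ n in atTop, tailPopularity (μ n) m < ε :=
    eventually_lt_of_limsup_lt hm
      (isBoundedUnder_of_eventually_le (a := 1) (Eventually.of_forall fun n =>
        tailPopularity_le_one (μ n) m))
  refine ⟨min δ₀ (1 / 2), by positivity, min_le_left _ _, min_le_right _ _, ?_⟩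
  filter_upwards [hev, hC_top.eventually_ge_atTop (2 * m / ε / ε), hC_top.eventually_gt_atTop 0,
    eventually_gt_atTop 0] with n hn hCn hC0 hn0 t₁ t₂ ht₁ h1 h2 hK₁ hK₂
  rw [div_le_iff₀ hε] at hCn
  have := (hμ n hn0).one_sub_meanCdf_le_of_tail hε ht₁ (min_le_right _ _) hC0 hK₁ hn.le
    (by linarith)
  linarith [(hμ n hn0).meanCdf_le_one t₂]

end asymptotics

theorem jointLaw_eq_pi {Ω : Type*} [MeasurableSpace Ω] {P : Measure Ω} [IsProbabilityMeasure P]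
    {n : ℕ} {N : Fin n → Ω → PointConfig} (hN : ∀ i, Measurable (N i)) (hindep : iIndepFun N P) :
    jointLaw P N = Measure.pi fun i => P.map (N i) :=
  (iIndepFun_iff_map_fun_eq_pi_map fun i => (hN i).aemeasurable).1 hindep

end Cache

theorem mainTheorem6 {Ω : Type*} [MeasurableSpace Ω] (P : Measure Ω) [IsProbabilityMeasure P]
    -- the request processes: independent, stationary and ergodic, with finite positive intensity
    (N : (n : ℕ) → Fin n → Ω → PointConfig)
    (hN : ∀ n i, Measurable (N n i))
    (hindep : ∀ n, iIndepFun (N n) P)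
    (hstat : ∀ n i, PointConfig.IsStationary (P.map (N n i)))
    (herg : ∀ n i, PointConfig.IsErgodic (P.map (N n i)))
    (hrate_pos : ∀ n i, 0 < Cache.intensity (Cache.jointLaw P (N n)) (fun ω => ω i))
    (hrate_fin : ∀ n i, Cache.intensity (Cache.jointLaw P (N n)) (fun ω => ω i) < ∞)
    -- continuous inter-request distributions, dominated after scaling by a common cdf
    (hG : ∀ n i, Continuous (Cache.interCdf (Cache.jointLaw P (N n)) i))
    (Ψ : Measure ℝ) [IsProbabilityMeasure Ψ]
    (hΨ_cont : Continuous (cdf Ψ))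
    (hΨ_supp : Ψ (Iio 0) = 0)
    (hΨ_mean : 0 < ∫ x, x ∂Ψ)
    (hGΨ : ∀ n i t, 1 - cdf Ψ t ≤ 1 - Cache.scaledCdf (Cache.jointLaw P (N n)) i t)
    -- cache sizes and characteristic times
    (C : ℕ → ℝ)
    (hC : ∀ᶠ n in atTop, 0 < C n ∧ C n < n)
    (hC_top : Tendsto C atTop atTop)
    (T : ℕ → ℝ)
    (hT : ∀ᶠ n in atTop, 0 ≤ T n ∧ C n = Cache.expectedSize (Cache.jointLaw P (N n)) (T n))
    -- the condition on the cache size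
    (β₁ : ℝ) (hβ₁ : β₁ ∈ Ioo 0 (∫ x, x ∂Ψ))
    (hC1 : ∀ᶠ n in atTop, C n ≤ β₁ * n)
    -- the condition on the popularity distribution
    (hP1 : ∃ κ₁ ∈ Ioo (1 / ∫ x, x ∂Ψ) (1 / β₁), ∃ κ₂ ∈ Icc (0 : ℝ) 1, ∃ γ ∈ Ioo (0 : ℝ) 1,
      ∀ᶠ n in atTop,
        γ * Cache.tailPopularity (Cache.jointLaw P (N n)) ⌊κ₂ * C n⌋₊
          < Cache.tailPopularity (Cache.jointLaw P (N n)) ⌈κ₁ * C n⌉₊)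
    -- either all standardized cdfs are equicontinuous, or those of each content are and the
    -- popularity tail is uniformly light
    (hR : (⋃ i, Cache.contentFamily P N i).UniformEquicontinuous ∨
      ((∀ i, (Cache.contentFamily P N i).UniformEquicontinuous) ∧
        Tendsto (fun m : ℕ =>
          limsup (fun n => Cache.tailPopularity (Cache.jointLaw P (N n)) m) atTop)
          atTop (𝓝 0))) :
    Tendsto (fun n => |Cache.hitLRU (Cache.jointLaw P (N n)) (C n)
      - Cache.hitTTL (Cache.jointLaw P (N n)) (T n)|) atTop (𝓝 0) := by
  have hprob : ∀ n i, IsProbabilityMeasure (P.map (N n i)) := fun n i =>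
    Measure.isProbabilityMeasure_map (hN n i).aemeasurable
  have hpi : ∀ n, Cache.jointLaw P (N n) = Measure.pi fun i => P.map (N n i) := fun n =>
    Cache.jointLaw_eq_pi (hN n) (hindep n)
  have hfin : ∀ n i, PointConfig.palmMeasure (P.map (N n i)) univ ≠ ∞ := fun n i => by
    rw [← Cache.intensity_pi (ν := fun i => P.map (N n i)) i, ← hpi]
    exact (hrate_fin n i).ne
  have hpos : ∀ n i, 0 < Cache.rate (Cache.jointLaw P (N n)) i := fun n i =>
    ENNReal.toReal_pos (hrate_pos n i).ne' (hrate_fin n i).ne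
  have hreg : ∀ n, 0 < n → Cache.IsRegular (Cache.jointLaw P (N n)) (cdf Ψ) := fun n hn => by
    have hpos' := hpos n
    have hle : ∀ i x, Cache.scaledCdf (Cache.jointLaw P (N n)) i x ≤ cdf Ψ x := fun i x => by
      linarith [hGΨ n i x]
    rw [hpi] at hpos' hle ⊢
    exact Cache.isRegular_pi (hstat n) (hfin n) hpos' hn hle
  obtain ⟨κ₁, hκ₁, κ₂, hκ₂, γ, hγ, hP⟩ := hP1
  have hmain : ∀ ε δ₀ : ℝ, 0 < ε → 0 < δ₀ → ∃ δ, 0 < δ ∧ δ ≤ δ₀ ∧ δ ≤ 1 / 2 ∧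
      ∀ᶠ n in atTop, ∀ t₁ t₂, 0 < t₁ → t₁ ≤ T n → T n ≤ t₂ →
        Cache.expectedSize (Cache.jointLaw P (N n)) t₁ = (1 - δ) * C n →
        Cache.expectedSize (Cache.jointLaw P (N n)) t₂ = (1 + δ) * C n →
        Cache.meanCdf (Cache.jointLaw P (N n)) t₂ - Cache.meanCdf (Cache.jointLaw P (N n)) t₁
          ≤ 8 * ε := by
    intro ε δ₀ hε hδ₀
    rcases hR with hR | ⟨-, htail⟩
    · refine Cache.eventually_meanCdf_sub_le_of_equicontinuous hreg hΨ_cont hΨ_supp hΨ_mean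
        (hC.mono fun n h => h.1) (hT.mono fun n h => h.2.symm) hκ₁.1 hκ₂.2 hγ.1 hP ?_ hε hδ₀
      intro ε' hε'
      obtain ⟨h, hh, hmod⟩ := Metric.uniformEquicontinuous_iff.1 hR ε' hε'
      refine ⟨h, hh, fun n i x y hxy => ?_⟩
      have := hmod x y hxy ⟨Cache.scaledCdf (Cache.jointLaw P (N n)) i,
        mem_iUnion.2 ⟨i.1, n, i.2, rfl⟩⟩
      rwa [Real.dist_eq] at this
    · exact Cache.eventually_meanCdf_sub_le_of_tail hreg hC_top htail hε hδ₀
  rw [Metric.tendsto_atTop']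
  -- For `δ` up to this value, `(1 + δ) β₁` is at most the midpoint of `β₁` and the mean of `Ψ`, so
  -- an expected size of `(1 + δ) C` is attainable.
  have hβ : 0 < ((∫ x, x ∂Ψ) - β₁) / (2 * β₁) :=
    div_pos (sub_pos.2 hβ₁.2) (mul_pos two_pos hβ₁.1)
  suffices h : ∀ ε > 0, ∀ᶠ n in atTop, |Cache.hitLRU (Cache.jointLaw P (N n)) (C n)
      - Cache.hitTTL (Cache.jointLaw P (N n)) (T n)| ≤ 9 * ε by
    intro ε hε
    obtain ⟨n₀, hn₀⟩ := eventually_atTop.1 (h (ε / 10) (by positivity))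
    refine ⟨n₀, fun n hn => ?_⟩
    rw [Real.dist_eq, sub_zero, abs_abs]
    linarith [hn₀ n hn.le]
  intro ε hε
  obtain ⟨δ, hδ0, hδβ, hδ1, hev⟩ := hmain ε _ hε hβ
  have hβδ : (1 + δ) * β₁ < ∫ x, x ∂Ψ := by
    rw [le_div_iff₀ (mul_pos two_pos hβ₁.1)] at hδβ
    nlinarith [hβ₁.2]
  obtain ⟨X, hX0, hX⟩ := Cache.exists_le_survivalIntegral_cdf Ψ hΨ_supp hΨ_mean hβδ
  filter_upwards [hev, hC, hT, hC1, eventually_gt_atTop 0, hC_top.eventually_ge_atTop (2 / δ),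
    hC_top.eventually_ge_atTop (8 / δ ^ 2 / ε)] with n hn hCn hTn hC1n hn0 hC2 hC3
  obtain ⟨t₁, t₂, ht₁, h1, h2, hK₁, hK₂⟩ := (hreg n hn0).exists_times (monotone_cdf Ψ) hX0 hX hCn.1
    hC1n hδ0 (by linarith) hTn.1 hTn.2.symm
  have hsub := hn t₁ t₂ ht₁ h1 h2 hK₁ hK₂
  have herr : 8 / (δ ^ 2 * C n) ≤ ε := by
    rw [div_le_iff₀ hε, div_le_iff₀ (by positivity)] at hC3
    rw [div_le_iff₀ (mul_pos (by positivity) hCn.1)]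
    linarith
  have hδC : 2 ≤ δ * C n := by
    rw [div_le_iff₀ hδ0] at hC2
    linarith
  have hposn := hpos n
  have hGn := hG n
  have hsum := (hreg n hn0).sum_rate_pos
  rw [hpi] at hposn hGn hsum hK₁ hK₂ hsub ⊢
  have := Cache.abs_hitLRU_sub_hitTTL_le (hstat n) (hfin n) hposn hGn hsum ht₁.le h1 h2 hδ0
    (by linarith) hδC hK₁ hK₂
  linarith
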